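/- Let $G=(V,E)$ be a finite simple graph. For $\alpha\in\mathbb R^V$ and $\beta\in\mathbb R^E$ let $\mathcal P(G,\alpha,\beta)$ be the probability measure on subsets of $V$ that gives $A\subseteq V$ the mass $\frac1Z e^{H(A)}$, where $H(A)=\sum_{u\in A}\alpha_u+\sum_{\{v,w\}\in E,\ \{v,w\}\subseteq A}\beta_{\{v,w\}}$ and $Z=\sum_{B\subseteq V}e^{H(B)}$. Let $G=K_{M,N}$ be the complete bipartite graph with classes $\hat V$, $\check V$ of sizes $M$ and $N$. For real numbers $\hat\alpha,\check\alpha,\beta$ write $\mathcal P(\hat\alpha,\check\alpha,\beta)$ for the measure $\mathcal P(G,\alpha,\beta)$ in which $\alpha_u=\hat\alpha$ for all $u\in\hat V$, $\alpha_v=\check\alpha$ for all $v\in\check V$, and every edge parameter equals $\beta$ (Model III). Given $T>0$ and values $\hat\alpha(T),\check\alpha(T),\beta(T)\in\mathbb R$, we say that the model with these prescribed values admits time-homogeneous Markovian dynamics if there is a time-homogeneous continuous-time Markov chain $(X_t)_{t\ge0}$ on the subsets of $V$, with jump rates $Q(A,B)$, such that $X_0=\emptyset$ almost surely; for $A\neq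 B$, $Q(A,B)=0$ unless $B=A\cup\{v\}$ for some $v\notin A$; $X_T$ has distribution $\mathcal P(\hat\alpha(T),\check\alpha(T),\beta(T))$; and for every $0<t<T$ there are real numbers $\hat\alpha(t),\check\alpha(t),\beta(t)$ such that $X_t$ has distribution $\mathcal P(\hat\alpha(t),\check\alpha(t),\beta(t))$. **Proposition.** Suppose that $M\ge4$ and $N\ge3$, or that $M\ge3$ and $N\ge4$. Let $T>0$ and let $\hat\alpha(T)\ne\check\alpha(T)$ be real numbers. Then there is $\varepsilon>0$ (which may depend on $M$, $N$, $T$, $\hat\alpha(T)$ and $\check\alpha(T)$) such that for every real $\beta(T)$ with $0<|\beta(T)|<\varepsilon$ the model with prescribed values $\hat\alpha(T),\check\alpha(T),\beta(T)$ does not admit time-homogeneous Markovian dynamics. -/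

import Mathlib

open scoped NNReal
open MeasureTheory

universe u

noncomputable section

namespace CorrelatedDefault

/-! ### The default model on a graph -/

section Model

variable {V : Type} [Fintype V] [DecidableEq V]

open Classical in
/-- The Hamiltonian `H(A) = ∑_{u ∈ A} α_u + ∑_{edges {v,w} ⊆ A} β_{vw}` of a set `A` of vertices
of the graph `G`. Only the values of `β` at edges of `G` matter. -/
def hamiltonian (G : SimpleGraph V) (α : V → ℝ) (β : Sym2 V → ℝ) (A : Finset V) : ℝ :=
  ∑ u ∈ A, α u +
    ∑ e ∈ Finset.univ.filter (fun e : Sym2 V => e ∈ G.edgeSet ∧ ∀ v ∈ e, v ∈ A), β e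

/-- The partition function. -/
def partitionFunction (G : SimpleGraph V) (α : V → ℝ) (β : Sym2 V → ℝ) : ℝ :=
  ∑ B : Finset V, Real.exp (hamiltonian G α β B)

/-- The probability that the set of defaulted firms is exactly `A`, under the default model
with parameters `α`, `β` on the graph `G`. -/
def defaultProb (G : SimpleGraph V) (α : V → ℝ) (β : Sym2 V → ℝ) (A : Finset V) : ℝ :=
  Real.exp (hamiltonian G α β A) / partitionFunction G α β

end Model

/-! ### Time-homogeneous Markov chains on a finite state space -/

section Chain

variable {S : Type} [Fintype S] [DecidableEq S]

/-- `Q` is a matrix of jump rates: the off-diagonal entries are nonnegative and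
`Q(A,A) = - ∑_{B ≠ A} Q(A,B)`. -/
structure IsRateMatrix (Q : Matrix S S ℝ) : Prop where
  nonneg : ∀ A B, A ≠ B → 0 ≤ Q A B
  diag : ∀ A, Q A A = -∑ B ∈ Finset.univ.erase A, Q A B

/-- The process `X = (X_t)_{t ≥ 0}` is a time-homogeneous Markov chain with jump rates `Q`:
conditionally on its values at the times `t_0 ≤ ⋯ ≤ t_n`, the chain is in state `B` at time
`t_n + h` with probability `exp (h Q) (X_{t_n}, B)`. -/
structure IsMarkovChain {Ω : Type u} [MeasurableSpace Ω] (μ : Measure Ω)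
    (X : ℝ≥0 → Ω → S) (Q : Matrix S S ℝ) : Prop where
  rates : IsRateMatrix Q
  measurable : ∀ t A, MeasurableSet {ω | X t ω = A}
  markov : ∀ (n : ℕ) (t : Fin (n + 1) → ℝ≥0) (A : Fin (n + 1) → S), Monotone t →
    ∀ (h : ℝ≥0) (B : S),
      μ.real {ω | (∀ i, X (t i) ω = A i) ∧ X (t (Fin.last n) + h) ω = B} =
        μ.real {ω | ∀ i, X (t i) ω = A i} *
          NormedSpace.exp ((h : ℝ) • Q) (A (Fin.last n)) B

end Chain

/-! ### Markovian dynamics for a default model -/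

/-- Let `F` be a set of parameter vectors for the default model on `G` (the model under
consideration). The default model with parameters `α`, `β` at time `T` admits time-homogeneous
Markovian dynamics within `F` if there is a time-homogeneous Markov chain on the subsets of the
vertex set, started at `∅`, whose only jumps add a single vertex, whose law at time `T` is the
prescribed one, and whose law at each time `0 < t ≤ T` is a default model on `G` with parameter
vectors `αt t`, `βt t` in `F`. -/
def AdmitsMarkovianDynamics {V : Type} [Fintype V] [DecidableEq V] (G : SimpleGraph V)
    (F : Set ((V → ℝ) × (Sym2 V → ℝ))) (T : ℝ≥0) (α : V → ℝ) (β : Sym2 V → ℝ) : Prop :=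
  ∃ (Ω : Type u) (_ : MeasurableSpace Ω) (μ : Measure Ω) (X : ℝ≥0 → Ω → Finset V)
    (Q : Matrix (Finset V) (Finset V) ℝ),
    IsProbabilityMeasure μ ∧
    IsMarkovChain μ X Q ∧
    (∀ A B, A ≠ B → Q A B ≠ 0 → ∃ v, v ∉ A ∧ B = insert v A) ∧
    (∀ᵐ ω ∂μ, X 0 ω = ∅) ∧
    (∀ A, μ.real {ω | X T ω = A} = defaultProb G α β A) ∧
    ∃ (αt : ℝ≥0 → V → ℝ) (βt : ℝ≥0 → Sym2 V → ℝ), ∀ t, 0 < t → t ≤ T →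
      (αt t, βt t) ∈ F ∧
      ∀ A, μ.real {ω | X t ω = A} = defaultProb G (αt t) (βt t) A

/-- The parameter vectors of the two-class model on the complete bipartite graph `K_{M,N}`: the
vertex parameter is constant on each of the two classes, and the edge parameter is constant. -/
def twoClassParams (M N : ℕ) :
    Set ((Fin M ⊕ Fin N → ℝ) × (Sym2 (Fin M ⊕ Fin N) → ℝ)) :=
  {θ | (∀ i j : Fin M, θ.1 (Sum.inl i) = θ.1 (Sum.inl j)) ∧
    (∀ i j : Fin N, θ.1 (Sum.inr i) = θ.1 (Sum.inr j)) ∧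
    ∀ e ∈ (completeBipartiteGraph (Fin M) (Fin N)).edgeSet,
      ∀ f ∈ (completeBipartiteGraph (Fin M) (Fin N)).edgeSet, θ.2 e = θ.2 f}

/-- The two-class model on `K_{M,N}` with prescribed values `a` and `c` of the vertex parameters
on the two classes and `b` of the edge parameter at time `T` admits time-homogeneous Markovian
dynamics. -/
def TwoClassAdmits (M N : ℕ) (T : ℝ≥0) (a c b : ℝ) : Prop :=
  AdmitsMarkovianDynamics.{u} (completeBipartiteGraph (Fin M) (Fin N)) (twoClassParams M N) T
    (Sum.elim (fun _ => a) (fun _ => c)) (fun _ => b)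

end CorrelatedDefault

end

/-! Since the law at each time depends on a set only through its type (i, j), summing the forward
equations over a type gives closed equations for the parameters, with total rates between types as
unknown constants; no symmetry of the chain is needed (`lumped_forward`, `twoClassFlow_of_forward`).
Put X = exp(-a), Y = exp(-c), y = exp(-b). The types (i, 0) and (0, j) determine the boundary rates
and yield a' = A X + κ, c' = B Y + l with A, B > 0. The type (1, 1) gives b', and each type (1, j)
then gives a relation X P_j(y) + m_j y Y + k_j = 0 with P_j(1) = 0; exchanging the classes gives
similar relations from (j, 1).

If y took infinitely many values, three such relations would have a determinant vanishing
identically in y. Its value at y = 1, compared with the linear independence of P_2 and P_3, is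
contradictory (`finite_interaction`). By continuity b is constant on (0, T].

For constant y ≠ 1 the relations make X and Y affinely dependent (`exists_odds_dependence`). Their
differential equations leave only BY = AX with l = κ, or BY = AX + κ with l = -κ (`odds_dependent`).
In the first case A/B = exp(a(T) - c(T)) ≠ 1, and in the second nonnegativity of a rate gives an
inequality; each is incompatible with the remaining equations at y = 1 by a margin that persists for
y near 1 (`eventually_no_equal_growth`, `eventually_no_opposite_growth`). -/

namespace CorrelatedDefault

open Set Filter Topology

/-! ### Polynomial identities on infinite sets -/

lemma polynomial_eval_eq_zero_of_infinite {S : Set ℝ} (hS : S.Infinite) (p : Polynomial ℝ)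
    (h : ∀ x ∈ S, p.eval x = 0) (x : ℝ) : p.eval x = 0 := by
  have : p = 0 := Polynomial.eq_zero_of_infinite_isRoot p (hS.mono fun x hx => h x hx)
  simp [this]

lemma quadratic_coeff_eq_zero {S : Set ℝ} (hS : S.Infinite) {α β γ : ℝ}
    (h : ∀ x ∈ S, α * x ^ 2 + β * x + γ = 0) : α = 0 ∧ β = 0 ∧ γ = 0 := by
  have key := polynomial_eval_eq_zero_of_infinite hS
    (Polynomial.C α * Polynomial.X ^ 2 + Polynomial.C β * Polynomial.X + Polynomial.C γ)
    (fun x hx => by simpa using h x hx)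
  have h0 := key 0
  have h1 := key 1
  have h2 := key (-1)
  simp at h0 h1 h2
  refine ⟨?_, ?_, ?_⟩ <;> linarith

/-! ### The lumped forward equations -/

/-- The logarithmic form of the forward equations of a chain on the types `(i, j)`, with total
rates `f i j` from type `(i, j)` to `(i + 1, j)` and `g i j` from `(i, j)` to `(i, j + 1)`, for
a law giving each set of type `(i, j)` the mass `exp (i a + j c + i j b - z)`. -/
structure TwoClassFlow (M N : ℕ) (T : ℝ) (f g : ℕ → ℕ → ℝ) (a c b z : ℝ → ℝ) : Prop where
  f_nonneg : ∀ i j, 0 ≤ f i j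
  g_nonneg : ∀ i j, 0 ≤ g i j
  f_top : ∀ j, f M j = 0
  g_top : ∀ i, g i N = 0
  deriv : ∀ i j, i ≤ M → j ≤ N → ∀ t ∈ Ioo 0 T,
    HasDerivAt (fun s => i * a s + j * c s + i * j * b s - z s)
      ((-(f i j + g i j) + (if i = 0 then 0 else f (i - 1) j) * Real.exp (-a t - j * b t)
        + (if j = 0 then 0 else g i (j - 1)) * Real.exp (-c t - i * b t)) /
          (M.choose i * N.choose j)) t
  cont_a : ContinuousOn a (Ioc 0 T)
  cont_c : ContinuousOn c (Ioc 0 T)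
  cont_b : ContinuousOn b (Ioc 0 T)
  lim_a : Tendsto a (𝓝[>] 0) atBot
  lim_c : Tendsto c (𝓝[>] 0) atBot

/-- The common rate of the jumps from `∅` to the singletons of the first class. -/
noncomputable def birthRate (M : ℕ) (f : ℕ → ℕ → ℝ) : ℝ := f 0 0 / M

/-- The growth rate of the odds ratio of the first class. -/
noncomputable def growthRate (M : ℕ) (f g : ℕ → ℕ → ℝ) : ℝ :=
  f 0 0 + g 0 0 - (f 1 0 + g 1 0) / M

/-- The excess of the birth rate over the growth rate, per vertex of the opposite class. -/
noncomputable def excess (M N : ℕ) (f g : ℕ → ℕ → ℝ) : ℝ :=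
  (birthRate M f - growthRate M f g) / N

namespace TwoClassFlow

variable {M N : ℕ} {T : ℝ} {f g : ℕ → ℕ → ℝ} {a c b z : ℝ → ℝ}

lemma swap (h : TwoClassFlow M N T f g a c b z) :
    TwoClassFlow N M T (fun i j => g j i) (fun i j => f j i) c a b z where
  f_nonneg i j := h.g_nonneg j i
  g_nonneg i j := h.f_nonneg j i
  f_top j := h.g_top j
  g_top i := h.f_top i
  deriv i j hi hj t ht := by
    convert h.deriv j i hj hi t ht using 1
    · ext s; ring
    · ring
  cont_a := h.cont_c
  cont_c := h.cont_a
  cont_b := h.cont_b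
  lim_a := h.lim_c
  lim_c := h.lim_a

lemma hasDerivAt_z (h : TwoClassFlow M N T f g a c b z) {t : ℝ} (ht : t ∈ Ioo 0 T) :
    HasDerivAt z (f 0 0 + g 0 0) t := by
  refine ((h.deriv 0 0 (Nat.zero_le _) (Nat.zero_le _) t ht).neg.congr_deriv ?_).congr_of_eventuallyEq
    (.of_forall fun s => ?_)
  · simp
  · simp

lemma hasDerivAt_a (h : TwoClassFlow M N T f g a c b z) (hM : 0 < M) {t : ℝ}
    (ht : t ∈ Ioo 0 T) :
    HasDerivAt a (birthRate M f * Real.exp (-a t) + growthRate M f g) t := by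
  have h1 := (h.deriv 1 0 hM (Nat.zero_le _) t ht).add (h.hasDerivAt_z ht)
  refine (h1.congr_deriv ?_).congr_of_eventuallyEq (.of_forall fun s => ?_)
  · simp [birthRate, growthRate]
    ring
  · simp

lemma hasDerivAt_c (h : TwoClassFlow M N T f g a c b z) (hN : 0 < N) {t : ℝ}
    (ht : t ∈ Ioo 0 T) :
    HasDerivAt c (birthRate N (fun i j => g j i) * Real.exp (-c t) +
      growthRate N (fun i j => g j i) (fun i j => f j i)) t :=
  h.swap.hasDerivAt_a hN ht

/-- The chain starts at the empty set, so a tends to -∞ at time 0 and the inverse odds are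
unbounded. This is what allows comparison of coefficients in polynomial identities along the flow.
-/
lemma infinite_odds (h : TwoClassFlow M N T f g a c b z) (hT : 0 < T) :
    ((fun t => Real.exp (-a t)) '' Ioo 0 T).Infinite := by
  have hlim : Tendsto (fun t => Real.exp (-a t)) (𝓝[>] 0) atTop :=
    Real.tendsto_exp_atTop.comp (tendsto_neg_atBot_atTop.comp h.lim_a)
  intro hfin
  obtain ⟨C, hC⟩ := hfin.bddAbove
  have h1 := (hlim.eventually (eventually_gt_atTop C)).and (Ioo_mem_nhdsGT hT)
  obtain ⟨t, ht1, ht2⟩ := h1.exists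
  exact absurd (hC ⟨t, ht2, rfl⟩) (not_le.mpr ht1)

lemma affine_coeff_eq_zero (h : TwoClassFlow M N T f g a c b z) (hT : 0 < T) {α β : ℝ}
    (hz : ∀ t ∈ Ioo 0 T, α * Real.exp (-a t) + β = 0) : α = 0 ∧ β = 0 := by
  have := quadratic_coeff_eq_zero (h.infinite_odds hT) (α := 0) (β := α) (γ := β) (by
    rintro _ ⟨t, ht, rfl⟩
    simpa using hz t ht)
  exact this.2

/-- With zero birth rate a would be affine in t, hence bounded near 0, contrary to a → -∞. -/
lemma birthRate_pos (h : TwoClassFlow M N T f g a c b z) (hM : 0 < M) (hT : 0 < T) :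
    0 < birthRate M f := by
  have h0 : 0 ≤ birthRate M f := div_nonneg (h.f_nonneg _ _) (Nat.cast_nonneg _)
  refine lt_of_le_of_ne h0 fun hA => ?_
  set κ := growthRate M f g
  have hd : ∀ t ∈ Ioo 0 T, HasDerivAt (fun s => a s - κ * s) 0 t := fun t ht => by
    refine ((h.hasDerivAt_a hM ht).sub ((hasDerivAt_id t).const_mul κ)).congr_deriv ?_
    simp [← hA, κ]
  have hconst : ∀ t ∈ Ioo 0 T, a t - κ * t = a (T / 2) - κ * (T / 2) := fun t ht =>
    isOpen_Ioo.is_const_of_deriv_eq_zero isPreconnected_Ioo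
      (fun s hs => (hd s hs).differentiableAt.differentiableWithinAt)
      (fun s hs => (hd s hs).deriv) ht ⟨by linarith, by linarith⟩
  have h1 := (h.lim_a.eventually (eventually_lt_atBot
    (a (T / 2) - κ * (T / 2) - |κ| * T))).and (Ioo_mem_nhdsGT hT)
  obtain ⟨t, ht1, ht2⟩ := h1.exists
  have h2 := hconst t ht2
  have h3 : |κ * t| ≤ |κ| * T := by
    rw [abs_mul, abs_of_pos ht2.1]
    exact mul_le_mul_of_nonneg_left ht2.2.le (abs_nonneg _)
  have := neg_abs_le (κ * t)
  linarith

/-- On types (i, 0) the logarithm of the mass is i a - z, whose derivative is already known from i =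
0 and i = 1. Equating it with the forward equation gives an affine identity in exp(-a), so both
coefficients vanish. -/
lemma boundary_rates (h : TwoClassFlow M N T f g a c b z) (hM : 0 < M) (hT : 0 < T) {i : ℕ}
    (hi : 1 ≤ i) (hiM : i ≤ M) :
    f (i - 1) 0 = i * M.choose i * birthRate M f ∧
      f i 0 + g i 0 = M.choose i * (f 0 0 + g 0 0 - i * growthRate M f g) := by
  have hC : (0 : ℝ) < M.choose i := by exact_mod_cast Nat.choose_pos hiM
  have hi0 : i ≠ 0 := by omega
  have key := h.affine_coeff_eq_zero hT
    (α := f (i - 1) 0 - i * M.choose i * birthRate M f)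
    (β := -(f i 0 + g i 0) + M.choose i * (f 0 0 + g 0 0 - i * growthRate M f g)) (by
      intro t ht
      have h1 := h.deriv i 0 hiM (Nat.zero_le _) t ht
      have h2 := ((h.hasDerivAt_a hM ht).const_mul (i : ℝ)).sub (h.hasDerivAt_z ht)
      have h3 : (fun s => (i : ℝ) * a s + ((0 : ℕ) : ℝ) * c s + i * ((0 : ℕ) : ℝ) * b s - z s) =
          fun s => (i : ℝ) * a s - z s := by
        ext s; simp
      rw [h3] at h1
      have h4 := h1.unique h2
      simp only [hi0, if_true, if_false, Nat.cast_zero, zero_mul, sub_zero, add_zero,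
        Nat.choose_zero_right, Nat.cast_one, mul_one] at h4
      rw [div_eq_iff hC.ne'] at h4
      linarith)
  constructor <;> linarith [key.1, key.2]

lemma outflow_boundary (h : TwoClassFlow M N T f g a c b z) (hM : 0 < M) (hN : 0 < N)
    (hT : 0 < T) {i : ℕ} (hi : 1 ≤ i) (hiM : i ≤ M) :
    g i 0 = M.choose i * N * (birthRate N (fun i j => g j i) + i * excess M N f g) := by
  -- The inflow formula at i + 1 gives f i 0 for i < M; at i = M both sides are 0. Subtracting it
  -- from the total outflow leaves g i 0.
  have hfi : f i 0 = M.choose i * (M - i) * birthRate M f := by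
    rcases hiM.eq_or_lt with rfl | hlt
    · simp [h.f_top]
    · have h1 := (h.boundary_rates hM hT (i := i + 1) (by omega) hlt).1
      have h2 : ((M.choose (i + 1) * (i + 1) : ℕ) : ℝ) = (M.choose i * (M - i) : ℕ) := by
        rw [Nat.choose_succ_right_eq]
      push_cast [Nat.cast_sub hiM] at h2
      simp only [Nat.add_sub_cancel, Nat.cast_add, Nat.cast_one] at h1
      rw [h1, ← h2]; ring
  have h2 := (h.boundary_rates hM hT hi hiM).2
  have hM' : (M : ℝ) ≠ 0 := by positivity
  have hN' : (N : ℝ) ≠ 0 := by positivity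
  have h3 : f 0 0 = M * birthRate M f := by unfold birthRate; field_simp
  have h4 : g 0 0 = N * birthRate N (fun i j => g j i) := by unfold birthRate; field_simp
  have h5 : N * excess M N f g = birthRate M f - growthRate M f g := by
    unfold excess; field_simp
  have h6 : (M.choose i : ℝ) * N * (birthRate N (fun i j => g j i) + i * excess M N f g) =
    M.choose i * (N * birthRate N (fun i j => g j i)) + M.choose i * i * (N * excess M N f g) := by
    ring
  rw [h6, h5, ← h4]
  rw [h3, hfi] at h2
  linarith

/-- This is nonnegativity of the total rate out of the type (M, 0). -/
lemma growthRate_le (h : TwoClassFlow M N T f g a c b z) (hM : 0 < M) (hT : 0 < T) :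
    M * growthRate M f g ≤ f 0 0 + g 0 0 := by
  have h1 := (h.boundary_rates hM hT (i := M) hM le_rfl).2
  have := h.f_nonneg M 0
  have := h.g_nonneg M 0
  simp at h1
  linarith

end TwoClassFlow

/-- The coefficient of `Y y` in the relation coming from the type `(1, j)`. -/
noncomputable def crossCoeff (M N : ℕ) (f g : ℕ → ℕ → ℝ) (j : ℕ) : ℝ :=
  j * (birthRate N (fun i j => g j i) + excess M N f g) - g 1 (j - 1) / (M * N.choose j)

/-- The logarithmic derivative of the interaction, as a function of the inverse odds `X`, `Y` and
of the inverse interaction `y`. -/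
noncomputable def interactionDrift (M N : ℕ) (f g : ℕ → ℕ → ℝ) (X Y y : ℝ) : ℝ :=
  ((birthRate M f + excess N M (fun i j => g j i) (fun i j => f j i)) * y - birthRate M f) * X +
    ((birthRate N (fun i j => g j i) + excess M N f g) * y - birthRate N (fun i j => g j i)) * Y +
    (f 0 0 + g 0 0 - (f 1 1 + g 1 1) / (M * N) - growthRate M f g -
      growthRate N (fun i j => g j i) (fun i j => f j i))

/-! ### Relations from the types (1, j) -/

namespace TwoClassFlow

variable {M N : ℕ} {T : ℝ} {f g : ℕ → ℕ → ℝ} {a c b z : ℝ → ℝ}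

lemma inflow_boundary (h : TwoClassFlow M N T f g a c b z) (hM : 0 < M) (hN : 0 < N)
    (hT : 0 < T) {j : ℕ} (hj : 1 ≤ j) (hjN : j ≤ N) :
    f 0 j = N.choose j * M *
      (birthRate M f + j * excess N M (fun i j => g j i) (fun i j => f j i)) :=
  h.swap.outflow_boundary hN hM hT hj hjN

lemma hasDerivAt_b (h : TwoClassFlow M N T f g a c b z) (hM : 0 < M) (hN : 0 < N)
    (hT : 0 < T) {t : ℝ} (ht : t ∈ Ioo 0 T) :
    HasDerivAt b (interactionDrift M N f g (Real.exp (-a t)) (Real.exp (-c t))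
      (Real.exp (-b t))) t := by
  have h1 := (((h.deriv 1 1 hM hN t ht).sub (h.hasDerivAt_a hM ht)).sub
    (h.hasDerivAt_c hN ht)).add (h.hasDerivAt_z ht)
  refine (h1.congr_deriv ?_).congr_of_eventuallyEq (.of_forall fun s => ?_)
  · have hM' : (M : ℝ) ≠ 0 := by positivity
    have hN' : (N : ℝ) ≠ 0 := by positivity
    have e1 := h.inflow_boundary hM hN hT le_rfl hN
    have e2 := h.outflow_boundary hM hN hT le_rfl hM
    simp only [Nat.choose_one_right, Nat.cast_one, one_mul] at e1 e2
    simp only [one_ne_zero, if_false, Nat.sub_self, Nat.choose_one_right, Nat.cast_one, one_mul,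
      sub_eq_add_neg (-a t), sub_eq_add_neg (-c t), Real.exp_add, e1, e2, interactionDrift]
    field_simp
    ring
  · simp
    ring

/-- The logarithm of the mass of type (1, j) is a + j c + j b - z, and all four derivatives are
known; comparison with its own forward equation leaves an algebraic relation. It carries information
from j = 2 on. -/
lemma exists_relation (h : TwoClassFlow M N T f g a c b z) (hM : 0 < M) (hT : 0 < T) {j : ℕ}
    (hj : 1 ≤ j) (hjN : j ≤ N) :
    ∃ k : ℝ, ∀ t ∈ Ioo 0 T,
      Real.exp (-a t) * (-(j - 1) * birthRate M f +
          j * (birthRate M f + excess N M (fun i j => g j i) (fun i j => f j i)) *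
            Real.exp (-b t) -
          (birthRate M f + j * excess N M (fun i j => g j i) (fun i j => f j i)) *
            Real.exp (-b t) ^ j) +
        Real.exp (-c t) * (crossCoeff M N f g j * Real.exp (-b t)) + k = 0 := by
  have hN : 0 < N := by omega
  set κ := growthRate M f g with hκ
  set l := growthRate N (fun i j => g j i) (fun i j => f j i) with hl
  refine ⟨κ + j * l - (f 0 0 + g 0 0) +
    j * (f 0 0 + g 0 0 - (f 1 1 + g 1 1) / (M * N) - κ - l) +
    (f 1 j + g 1 j) / (M * N.choose j), fun t ht => ?_⟩
  have h1 := h.deriv 1 j hM hjN t ht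
  have h2 := (((h.hasDerivAt_a hM ht).add ((h.hasDerivAt_c hN ht).const_mul (j : ℝ))).add
    ((h.hasDerivAt_b hM hN hT ht).const_mul (j : ℝ))).sub (h.hasDerivAt_z ht)
  have h3 := h2.unique (h1.congr_of_eventuallyEq (.of_forall fun s => by simp))
  have hM' : (M : ℝ) ≠ 0 := by positivity
  have hC : (N.choose j : ℝ) ≠ 0 := by exact_mod_cast (Nat.choose_pos hjN).ne'
  have hj0 : j ≠ 0 := by omega
  have e1 := h.inflow_boundary hM hN hT hj hjN
  have e3 : Real.exp (-a t - j * b t) = Real.exp (-a t) * Real.exp (-b t) ^ j := by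
    rw [← Real.exp_nat_mul, ← Real.exp_add]
    ring_nf
  have e4 : Real.exp (-c t - (1 : ℕ) * b t) = Real.exp (-c t) * Real.exp (-b t) := by
    rw [← Real.exp_add]
    ring_nf
  rw [e3, e4] at h3
  simp only [one_ne_zero, if_false, Nat.sub_self, hj0, Nat.choose_one_right, e1, interactionDrift,
    ← hκ, ← hl, add_div, neg_add, neg_div] at h3
  have e5 : ∀ w v : ℝ, (N.choose j : ℝ) * M * w * v / (M * N.choose j) = w * v := fun w v => by
    field_simp
  rw [e5] at h3
  simp only [crossCoeff, add_div]
  linear_combination h3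

end TwoClassFlow

/-! ### Constancy of the interaction -/

lemma cubic_coeff_eq_zero {S : Set ℝ} (hS : S.Infinite) {α β γ δ : ℝ}
    (h : ∀ x ∈ S, α * x ^ 3 + β * x ^ 2 + γ * x + δ = 0) : α = 0 ∧ β = 0 ∧ γ = 0 ∧ δ = 0 := by
  have key := polynomial_eval_eq_zero_of_infinite hS
    (Polynomial.C α * Polynomial.X ^ 3 + Polynomial.C β * Polynomial.X ^ 2 +
      Polynomial.C γ * Polynomial.X + Polynomial.C δ)
    (fun x hx => by simpa using h x hx)
  have h0 := key 0
  have h1 := key 1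
  have h2 := key (-1)
  have h3 := key 2
  simp at h0 h1 h2 h3
  refine ⟨?_, ?_, ?_, ?_⟩ <;> linarith

/-- The polynomials P_2 and P_3 multiplying X are linearly independent because A ≠ 0. If the
determinant vanished, eliminating Y would also eliminate the constants and conversely, so m₂ = k₂ =
0; the first relation would then read X P_2(y) = 0. -/
lemma relations_not_proportional {I : Set ℝ} {X Y y : ℝ → ℝ} (hX : ∀ t ∈ I, X t ≠ 0)
    (hy : (y '' I).Infinite) {A e m₂ m₃ k₂ k₃ : ℝ} (hA : A ≠ 0)
    (h₂ : ∀ t ∈ I, X t * (-A + 2 * (A + e) * y t - (A + 2 * e) * y t ^ 2) +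
      Y t * (m₂ * y t) + k₂ = 0)
    (h₃ : ∀ t ∈ I, X t * (-2 * A + 3 * (A + e) * y t - (A + 3 * e) * y t ^ 3) +
      Y t * (m₃ * y t) + k₃ = 0) :
    m₂ * k₃ - m₃ * k₂ ≠ 0 := by
  intro hdet
  have indep : ∀ r s : ℝ, (∀ t ∈ I, X t *
      (r * (-2 * A + 3 * (A + e) * y t - (A + 3 * e) * y t ^ 3) -
        s * (-A + 2 * (A + e) * y t - (A + 2 * e) * y t ^ 2)) = 0) → r = 0 ∧ s = 0 := by
    intro r s hrs
    obtain ⟨h3, -, h1, h0⟩ := cubic_coeff_eq_zero hy (α := -(r * (A + 3 * e)))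
      (β := s * (A + 2 * e)) (γ := (3 * r - 2 * s) * (A + e)) (δ := (s - 2 * r) * A) (by
        rintro _ ⟨t, ht, rfl⟩
        have := (mul_eq_zero.mp (hrs t ht)).resolve_left (hX t ht)
        linear_combination this)
    have hs : s = 2 * r := by
      have := (mul_eq_zero.mp h0).resolve_right hA
      linarith
    have hr : r = 0 := by
      by_contra hr
      have e1 := (mul_eq_zero.mp (neg_eq_zero.mp h3)).resolve_left hr
      have e2 := (mul_eq_zero.mp h1).resolve_left (by rw [hs]; intro h; apply hr; linarith)
      apply hA
      linarith
    exact ⟨hr, by rw [hs, hr, mul_zero]⟩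
  obtain ⟨hm₂, -⟩ := indep m₂ m₃ fun t ht => by
    linear_combination m₂ * h₃ t ht - m₃ * h₂ t ht - hdet
  obtain ⟨hk₂, -⟩ := indep k₂ k₃ fun t ht => by
    linear_combination k₂ * h₃ t ht - k₃ * h₂ t ht + Y t * y t * hdet
  refine one_ne_zero (indep 0 1 fun t ht => ?_).2
  have := h₂ t ht
  rw [hm₂, hk₂] at this
  linear_combination -this

lemma transverse_coeff_eq_zero {I : Set ℝ} {X Y y : ℝ → ℝ} (hy : (y '' I).Infinite)
    {P₂ P₃ R : Polynomial ℝ} {m₂ m₃ k₂ k₃ n l : ℝ}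
    (hP₂ : P₂.eval 1 = 0) (hP₃ : P₃.eval 1 = 0) (hR : R.eval 1 = 0)
    (h₂ : ∀ t ∈ I, X t * P₂.eval (y t) + Y t * (m₂ * y t) + k₂ = 0)
    (h₃ : ∀ t ∈ I, X t * P₃.eval (y t) + Y t * (m₃ * y t) + k₃ = 0)
    (h : ∀ t ∈ I, Y t * R.eval (y t) + X t * (n * y t) + l = 0)
    (hdet : m₂ * k₃ - m₃ * k₂ ≠ 0) : n = 0 := by
  -- The vector (X, Y, 1) is in the kernel of the 3 × 3 coefficient matrix, so its determinant, a
  -- polynomial in y, has infinitely many roots and vanishes identically. It may be evaluated at 1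
  -- whether or not y takes that value; there only n (m₂ k₃ - m₃ k₂) survives.
  have key := polynomial_eval_eq_zero_of_infinite hy
    (P₂ * (Polynomial.C (m₃ * l) * Polynomial.X - Polynomial.C k₃ * R) -
      Polynomial.C m₂ * Polynomial.X *
        (Polynomial.C l * P₃ - Polynomial.C (k₃ * n) * Polynomial.X) +
      Polynomial.C k₂ * (P₃ * R - Polynomial.C (m₃ * n) * Polynomial.X ^ 2)) (by
      rintro _ ⟨t, ht, rfl⟩
      simp only [Polynomial.eval_add, Polynomial.eval_sub, Polynomial.eval_mul,
        Polynomial.eval_C, Polynomial.eval_X, Polynomial.eval_pow]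
      linear_combination
        (P₃.eval (y t) * R.eval (y t) - m₃ * y t * (n * y t)) * h₂ t ht
        - (P₂.eval (y t) * R.eval (y t) - m₂ * y t * (n * y t)) * h₃ t ht
        + (P₂.eval (y t) * (m₃ * y t) - m₂ * y t * P₃.eval (y t)) * h t ht) 1
  simp only [Polynomial.eval_add, Polynomial.eval_sub, Polynomial.eval_mul,
    Polynomial.eval_C, Polynomial.eval_X, Polynomial.eval_pow, hP₂, hP₃, hR] at key
  have : n * (m₂ * k₃ - m₃ * k₂) = 0 := by linear_combination key
  exact (mul_eq_zero.mp this).resolve_right hdet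

/-- The coefficient polynomial of `X` in the relation coming from the type `(1, j)`. -/
noncomputable def relationPoly (A e : ℝ) (j : ℕ) : Polynomial ℝ :=
  Polynomial.C (-(j - 1) * A) + Polynomial.C (j * (A + e)) * Polynomial.X -
    Polynomial.C (A + j * e) * Polynomial.X ^ j

lemma eval_relationPoly (A e : ℝ) (j : ℕ) (x : ℝ) :
    (relationPoly A e j).eval x = -(j - 1) * A + j * (A + e) * x - (A + j * e) * x ^ j := by
  simp [relationPoly]

namespace TwoClassFlow

variable {M N : ℕ} {T : ℝ} {f g : ℕ → ℕ → ℝ} {a c b z : ℝ → ℝ}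

lemma crossCoeff_det_ne_zero (h : TwoClassFlow M N T f g a c b z) (hM : 0 < M) (hT : 0 < T)
    (hinf : ((fun t => Real.exp (-b t)) '' Ioo 0 T).Infinite) {k₂ k₃ : ℝ}
    (h₂ : ∀ t ∈ Ioo 0 T, Real.exp (-a t) *
      (relationPoly (birthRate M f) (excess N M (fun i j => g j i) (fun i j => f j i)) 2).eval
        (Real.exp (-b t)) +
      Real.exp (-c t) * (crossCoeff M N f g 2 * Real.exp (-b t)) + k₂ = 0)
    (h₃ : ∀ t ∈ Ioo 0 T, Real.exp (-a t) *
      (relationPoly (birthRate M f) (excess N M (fun i j => g j i) (fun i j => f j i)) 3).eval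
        (Real.exp (-b t)) +
      Real.exp (-c t) * (crossCoeff M N f g 3 * Real.exp (-b t)) + k₃ = 0) :
    crossCoeff M N f g 2 * k₃ - crossCoeff M N f g 3 * k₂ ≠ 0 := by
  simp only [eval_relationPoly] at h₂ h₃
  refine relations_not_proportional (fun t _ => (Real.exp_pos (-a t)).ne') hinf
    (h.birthRate_pos hM hT).ne'
    (e := excess N M (fun i j => g j i) (fun i j => f j i)) (Y := fun t => Real.exp (-c t))
    (fun t ht => ?_) fun t ht => ?_
  · have := h₂ t ht
    push_cast at this
    linear_combination this
  · have := h₃ t ht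
    push_cast at this
    linear_combination this

lemma exists_relation' (h : TwoClassFlow M N T f g a c b z) (hM : 0 < M) (hT : 0 < T) {j : ℕ}
    (hj : 1 ≤ j) (hjN : j ≤ N) :
    ∃ k : ℝ, ∀ t ∈ Ioo 0 T, Real.exp (-a t) *
      (relationPoly (birthRate M f) (excess N M (fun i j => g j i) (fun i j => f j i)) j).eval
        (Real.exp (-b t)) +
      Real.exp (-c t) * (crossCoeff M N f g j * Real.exp (-b t)) + k = 0 := by
  simp only [eval_relationPoly]
  exact h.exists_relation hM hT hj hjN

/-- The relations from (1, 2) and (1, 3), joined with the one from (2, 1) or (3, 1), force both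
cross coefficients of the exchanged model to vanish. This contradicts the nonzero determinant of
that model. -/
lemma finite_interaction (h : TwoClassFlow M N T f g a c b z) (hM : 3 ≤ M) (hN : 3 ≤ N)
    (hT : 0 < T) : ((fun t => Real.exp (-b t)) '' Ioo 0 T).Finite := by
  by_contra hinf
  obtain ⟨k₂, hk₂⟩ := h.exists_relation' (j := 2) (by omega) hT (by omega) (by omega)
  obtain ⟨k₃, hk₃⟩ := h.exists_relation' (j := 3) (by omega) hT (by omega) (by omega)
  obtain ⟨l₂, hl₂⟩ := h.swap.exists_relation' (j := 2) (by omega) hT (by omega) (by omega)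
  obtain ⟨l₃, hl₃⟩ := h.swap.exists_relation' (j := 3) (by omega) hT (by omega) (by omega)
  have hdet := h.crossCoeff_det_ne_zero (by omega) hT hinf hk₂ hk₃
  have hdet' := h.swap.crossCoeff_det_ne_zero (by omega) hT hinf hl₂ hl₃
  have eval_one : ∀ A e : ℝ, ∀ j : ℕ, (relationPoly A e j).eval 1 = 0 := fun A e j => by
    rw [eval_relationPoly]
    ring
  have n₂ := transverse_coeff_eq_zero hinf (eval_one _ _ _) (eval_one _ _ _) (eval_one _ _ _)
    hk₂ hk₃ hl₂ hdet
  have n₃ := transverse_coeff_eq_zero hinf (eval_one _ _ _) (eval_one _ _ _) (eval_one _ _ _)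
    hk₂ hk₃ hl₃ hdet
  rw [n₂, n₃] at hdet'
  simp at hdet'

lemma interaction_const (h : TwoClassFlow M N T f g a c b z) (hM : 3 ≤ M) (hN : 3 ≤ N)
    (hT : 0 < T) {t : ℝ} (ht : t ∈ Ioc 0 T) : b t = b T := by
  have hfin : ((fun t => Real.exp (-b t)) '' Ioc 0 T).Finite := by
    rw [← Ioo_insert_right hT, image_insert_eq]
    exact (h.finite_interaction hM hN hT).insert _
  have hpre : IsPreconnected ((fun t => Real.exp (-b t)) '' Ioc 0 T) :=
    isPreconnected_Ioc.image _ h.cont_b.neg.rexp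
  -- A finite connected set of reals has at most one point.
  have hsub : ((fun t => Real.exp (-b t)) '' Ioc 0 T).Subsingleton := by
    rw [← not_nontrivial_iff]
    exact fun hn => hpre.infinite_of_nontrivial hn hfin
  have := hsub ⟨t, ht, rfl⟩ ⟨T, ⟨hT, le_rfl⟩, rfl⟩
  exact neg_injective (Real.exp_injective this)

end TwoClassFlow

/-! ### Constant interaction -/

/-- The case BY = AX after division by B: ρ is A/B, a and b are the two excesses, m and n the two
cross coefficients. The first two equations determine a and b, the last two m and n, and the third
then fails at y = 1, hence nearby. -/
lemma eventually_no_equal_growth {M N ρ : ℝ} (hM : 0 < M) (hN : 0 < N) (hρ : 0 < ρ)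
    (hρ1 : ρ ≠ 1) :
    ∀ᶠ y in 𝓝 (1 : ℝ), 0 < y → ∀ a b m n : ℝ, y * (b + a * ρ) = 2 * ρ * (1 - y) →
      M * b - N * a = 1 - ρ → 2 * (a + b) + (N - 1) * m + (M - 1) * n = 0 →
      (-ρ + 2 * (ρ + b) * y - (ρ + 2 * b) * y ^ 2) + m * y * ρ = 0 →
      n * y + (-1 + 2 * (1 + a) * y - (1 + 2 * a) * y ^ 2) * ρ = 0 → False := by
  set a₁ : ℝ → ℝ := fun y => (2 * M * ρ * (y⁻¹ - 1) - (1 - ρ)) / (M * ρ + N) with ha₁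
  set b₁ : ℝ → ℝ := fun y => 2 * ρ * (y⁻¹ - 1) - a₁ y * ρ with hb₁
  set F : ℝ → ℝ := fun y => 2 * (a₁ y + b₁ y) +
    (N - 1) * (-((-ρ + 2 * (ρ + b₁ y) * y - (ρ + 2 * b₁ y) * y ^ 2) * (y⁻¹ * ρ⁻¹))) +
    (M - 1) * (-((-1 + 2 * (1 + a₁ y) * y - (1 + 2 * a₁ y) * y ^ 2) * ρ * y⁻¹)) with hF
  have hD : M * ρ + N ≠ 0 := by positivity
  have hinv : ContinuousAt (fun y : ℝ => y⁻¹) 1 := continuousAt_inv₀ one_ne_zero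
  have hca : ContinuousAt a₁ 1 := by fun_prop
  have hcb : ContinuousAt b₁ 1 := by fun_prop
  have hcF : ContinuousAt F 1 := by fun_prop
  -- At y = 1 the terms from m and n vanish and b = -aρ, so only 2a(1 - ρ) remains.
  have hF1 : F 1 ≠ 0 := by
    have e1 : a₁ 1 = -(1 - ρ) / (M * ρ + N) := by simp [ha₁]
    have e2 : F 1 = -2 * (1 - ρ) ^ 2 / (M * ρ + N) := by
      simp only [hF, hb₁, e1]
      field_simp
      ring
    rw [e2]
    have : (1 - ρ) ≠ 0 := sub_ne_zero.mpr hρ1.symm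
    have h2 : -2 * (1 - ρ) ^ 2 ≠ 0 := by simpa using this
    exact div_ne_zero h2 hD
  filter_upwards [hcF.eventually_ne hF1] with y hy hy0 a b m n e1 e2 e3 e4 e5
  have hb : b = 2 * ρ * (y⁻¹ - 1) - a * ρ := by
    field_simp
    linear_combination e1
  have ha : a = a₁ y := by
    simp only [ha₁]
    rw [eq_div_iff hD]
    rw [hb] at e2
    linear_combination -e2
  have hb' : b = b₁ y := by rw [hb, ha]
  have hm : m = -((-ρ + 2 * (ρ + b₁ y) * y - (ρ + 2 * b₁ y) * y ^ 2) * (y⁻¹ * ρ⁻¹)) := by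
    rw [← hb']
    field_simp
    linear_combination e4
  have hn : n = -((-1 + 2 * (1 + a₁ y) * y - (1 + 2 * a₁ y) * y ^ 2) * ρ * y⁻¹) := by
    rw [← ha]
    field_simp
    linear_combination e5
  apply hy
  simp only [hF]
  rw [← hm, ← hn, ← ha, ← hb']
  exact e3

/-- For s = 0 the left side of the last equation is positive: if A < 1, then NB ≥ M(1 - A) makes its
first term dominate. The lower bound v on B makes this robust under small s. -/
lemma no_opposite_growth_aux {M N v η s A B : ℝ} (hM : 1 ≤ M) (hN : 1 ≤ N) (hv : 0 < v)
    (hη : η ≤ 1 / (4 * M * N)) (hη' : η < v ^ 2 / (2 * M * (1 + v))) (hs : |s| ≤ η)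
    (hA : 0 < A) (hB : v ≤ B) (hq : M ≤ M * A + N * B)
    (h : N * B * (B + 1) + M * A * (A - 1) = 2 * M * N * A * B * s) : False := by
  have hη0 : 0 ≤ η := (abs_nonneg s).trans hs
  have hs' : s ≤ η := (le_abs_self s).trans hs
  have hB0 : 0 < B := hv.trans_le hB
  have hM0 : 0 < M := by linarith
  have hN0 : 0 < N := by linarith
  have h1 : N * B * (B + 1) + M * A * (A - 1) ≤ 2 * M * N * A * B * η := by
    rw [h]
    gcongr
  rw [le_div_iff₀ (by positivity)] at hη
  rw [lt_div_iff₀ (by positivity)] at hη'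
  have hMη : 4 * M * η ≤ 1 := by
    have : 0 ≤ 4 * M * η * (N - 1) := by have := sub_nonneg.mpr hN; positivity
    linarith
  have hNη : 4 * N * η ≤ 1 := by
    have : 0 ≤ 4 * N * η * (M - 1) := by have := sub_nonneg.mpr hM; positivity
    linarith
  rcases le_or_gt 1 A with hA1 | hA1
  -- Here B + 1 ≤ A/2 and A - 1 ≤ B/2, whose sum is impossible.
  · have h2 : B + 1 ≤ 2 * M * A * η := by
      have h3 : N * B * (B + 1) ≤ N * B * (2 * M * A * η) := by
        have : 0 ≤ M * A * (A - 1) := by have := sub_nonneg.mpr hA1; positivity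
        linarith
      exact le_of_mul_le_mul_left h3 (by positivity)
    have h4 : A - 1 ≤ 2 * N * B * η := by
      have h3 : M * A * (A - 1) ≤ M * A * (2 * N * B * η) := by
        have : 0 ≤ N * B * (B + 1) := by positivity
        linarith
      exact le_of_mul_le_mul_left h3 (by positivity)
    have h5 : 4 * M * η * A ≤ 1 * A := by gcongr
    have h6 : 4 * N * η * B ≤ 1 * B := by gcongr
    linarith
  · have h2 : M * (1 - A) * (B + 1) ≤ N * B * (B + 1) :=
      mul_le_mul_of_nonneg_right (by linarith) (by positivity)
    have h3 : (1 - A) * B ≤ 2 * N * η * B := by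
      have h4 : M * ((1 - A) * (B + (1 - A))) ≤ M * (2 * N * A * B * η) := by linarith
      have h5 := le_of_mul_le_mul_left h4 hM0
      have h6 : 2 * N * A * B * η ≤ 2 * N * 1 * B * η := by gcongr
      have h7 := mul_self_nonneg (1 - A)
      linarith
    have h4 : 1 - A ≤ 2 * N * η := le_of_mul_le_mul_right h3 hB0
    have h5 : M * A * (1 - A) ≤ M * 1 * (2 * N * η) := by
      have := sub_nonneg.mpr hA1.le
      gcongr
    have h6 : 2 * M * N * A * B * η ≤ 2 * M * N * 1 * B * η := by gcongr
    -- As B²/(1 + B) increases with B ≥ v, this contradicts the second bound on η.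
    have h7 : B ^ 2 ≤ 2 * M * η * (1 + B) := by
      have : N * B ^ 2 ≤ N * (2 * M * η * (1 + B)) := by
        have : 0 < N * B := by positivity
        linarith
      exact le_of_mul_le_mul_left this hN0
    have h8 : B ^ 2 * (1 + v) < v ^ 2 * (1 + B) := by
      calc B ^ 2 * (1 + v) ≤ 2 * M * η * (1 + B) * (1 + v) := by gcongr
        _ = η * (2 * M * (1 + v)) * (1 + B) := by ring
        _ < v ^ 2 * (1 + B) := by gcongr
    have h9 : v ^ 2 ≤ B ^ 2 := by gcongr
    have h10 : 0 ≤ v * B * (B - v) := by have := sub_nonneg.mpr hB; positivity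
    linarith

lemma eventually_no_opposite_growth {M N v : ℝ} (hM : 1 ≤ M) (hN : 1 ≤ N) (hv : 0 < v) :
    ∀ᶠ y in 𝓝 (1 : ℝ), 0 < y → ∀ A B κ : ℝ, 0 < A → 0 < κ → v * κ ≤ B →
      M * κ ≤ M * A + N * B →
      y * (N * B * (B + κ) + M * A * (A - κ)) = 2 * M * N * A * B * (1 - y) → False := by
  -- The extra factor 1/2 provides the strict inequality. After scaling κ to 1, the perturbation s
  -- is y⁻¹ - 1.
  set η := min (1 / (4 * M * N)) (v ^ 2 / (2 * M * (1 + v)) / 2) with hη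
  have h0 : 0 < v ^ 2 / (2 * M * (1 + v)) := by positivity
  have hη0 : 0 < η := lt_min (by positivity) (by positivity)
  have hlim : ContinuousAt (fun y : ℝ => |y⁻¹ - 1|) 1 :=
    ((continuousAt_inv₀ one_ne_zero).sub continuousAt_const).abs
  have hev : ∀ᶠ y in 𝓝 (1 : ℝ), |y⁻¹ - 1| < η := by
    apply hlim.eventually_lt continuousAt_const
    simpa using hη0
  filter_upwards [hev] with y hy hy0 A B κ hA hκ hB hq h
  refine no_opposite_growth_aux (A := A / κ) (B := B / κ) hM hN hv (min_le_left _ _)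
    ((min_le_right _ _).trans_lt (half_lt_self h0)) hy.le (by positivity)
    ((le_div_iff₀ hκ).mpr hB) ?_ ?_
  · have e : M * (A / κ) + N * (B / κ) = (M * A + N * B) / κ := by ring
    rw [e, le_div_iff₀ hκ]
    exact hq
  · field_simp
    linear_combination h

/-! ### Affine dependence of the inverse odds -/

namespace TwoClassFlow

variable {M N : ℕ} {T : ℝ} {f g : ℕ → ℕ → ℝ} {a c b z : ℝ → ℝ}

lemma odds_dependent (h : TwoClassFlow M N T f g a c b z) (hM : 0 < M) (hN : 0 < N)
    (hT : 0 < T) {α β γ : ℝ} (hne : α ≠ 0 ∨ β ≠ 0)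
    (hrel : ∀ t ∈ Ioo 0 T, α * Real.exp (-a t) + β * Real.exp (-c t) + γ = 0) :
    ∃ δ : ℝ, (∀ t ∈ Ioo 0 T, birthRate N (fun i j => g j i) * Real.exp (-c t) =
        birthRate M f * Real.exp (-a t) + δ) ∧
      ((δ = 0 ∧ growthRate N (fun i j => g j i) (fun i j => f j i) = growthRate M f g) ∨
        (δ = growthRate M f g ∧
          growthRate N (fun i j => g j i) (fun i j => f j i) = -growthRate M f g)) := by
  set A := birthRate M f
  set B := birthRate N (fun i j => g j i)
  set κ := growthRate M f g
  set l := growthRate N (fun i j => g j i) (fun i j => f j i)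
  have hβ : β ≠ 0 := by
    rintro rfl
    have := (h.affine_coeff_eq_zero hT (α := α) (β := γ) fun t ht => by
      simpa using hrel t ht).1
    simp [this] at hne
  have hα : α ≠ 0 := by
    rintro rfl
    exact hβ (h.swap.affine_coeff_eq_zero hT (α := β) (β := γ) fun t ht => by
      simpa using hrel t ht).1
  have hder : ∀ t ∈ Ioo 0 T, α * (Real.exp (-a t) * -(A * Real.exp (-a t) + κ)) +
      β * (Real.exp (-c t) * -(B * Real.exp (-c t) + l)) = 0 := fun t ht => by
    have h1 := (((h.hasDerivAt_a hM ht).neg.exp.const_mul α).add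
      ((h.hasDerivAt_c hN ht).neg.exp.const_mul β)).add_const γ
    refine h1.unique ((hasDerivAt_const t (0 : ℝ)).congr_of_eventuallyEq ?_)
    filter_upwards [isOpen_Ioo.mem_nhds ht] with s hs
    simpa using hrel s hs
  -- Differentiating the relation by means of X' = -X(AX + κ) and Y' = -Y(BY + l), then eliminating
  -- Y, gives a quadratic in X that vanishes identically.
  obtain ⟨e2, e1, e0⟩ := quadratic_coeff_eq_zero (h.infinite_odds hT)
    (α := α * (β * A + B * α)) (β := α * (β * κ + 2 * B * γ - l * β))
    (γ := γ * (B * γ - l * β)) (by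
      rintro _ ⟨t, ht, rfl⟩
      have h1 := hrel t ht
      have h2 := hder t ht
      simp only
      linear_combination -β * h2 + (B * (α * Real.exp (-a t) + γ) - l * β -
        B * β * Real.exp (-c t)) * h1)
  have e2' := (mul_eq_zero.mp e2).resolve_left hα
  have e1' := (mul_eq_zero.mp e1).resolve_left hα
  refine ⟨-(B * γ / β), fun t ht => ?_, ?_⟩
  · field_simp
    linear_combination B * hrel t ht - Real.exp (-a t) * e2'
  · rcases mul_eq_zero.mp e0 with h0 | h0
    · left
      refine ⟨by simp [h0], ?_⟩
      rw [h0] at e1'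
      have : β * (κ - l) = 0 := by linear_combination e1'
      linarith [(mul_eq_zero.mp this).resolve_left hβ]
    · right
      have hl : l = B * γ / β := by
        field_simp
        linear_combination -h0
      have hκ : κ = -l := by
        have : β * (κ + l) = 0 := by linear_combination e1' - 2 * h0
        linarith [(mul_eq_zero.mp this).resolve_left hβ]
      exact ⟨by rw [hκ, hl], by rw [hκ, neg_neg]⟩

lemma odds_relation_terminal (h : TwoClassFlow M N T f g a c b z) (hT : 0 < T) {A B δ : ℝ}
    (hrel : ∀ t ∈ Ioo 0 T, B * Real.exp (-c t) = A * Real.exp (-a t) + δ) :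
    B * Real.exp (-c T) = A * Real.exp (-a T) + δ := by
  have h1 : EqOn (fun t => B * Real.exp (-c t)) (fun t => A * Real.exp (-a t) + δ) (Ioc 0 T) :=
    EqOn.of_subset_closure (s := Ioo 0 T) hrel (h.cont_c.neg.rexp.const_smul B)
      ((h.cont_a.neg.rexp.const_smul A).add continuousOn_const) Ioo_subset_Ioc_self
      (by rw [closure_Ioo hT.ne]; exact Ioc_subset_Icc_self)
  exact h1 ⟨hT, le_rfl⟩

lemma coeff_of_odds_relation (h : TwoClassFlow M N T f g a c b z) (hT : 0 < T)
    {A B δ α β γ : ℝ}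
    (hAB : ∀ t ∈ Ioo 0 T, B * Real.exp (-c t) = A * Real.exp (-a t) + δ)
    (hrel : ∀ t ∈ Ioo 0 T, α * Real.exp (-a t) + β * Real.exp (-c t) + γ = 0) :
    α * B + β * A = 0 ∧ β * δ + γ * B = 0 :=
  h.affine_coeff_eq_zero hT fun t ht => by
    linear_combination B * hrel t ht - β * hAB t ht

lemma interactionDrift_eq_zero (h : TwoClassFlow M N T f g a c b z) (hM : 3 ≤ M) (hN : 3 ≤ N)
    (hT : 0 < T) {t : ℝ} (ht : t ∈ Ioo 0 T) :
    interactionDrift M N f g (Real.exp (-a t)) (Real.exp (-c t)) (Real.exp (-b T)) = 0 := by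
  have h1 := h.hasDerivAt_b (by omega) (by omega) hT ht
  rw [h.interaction_const hM hN hT ⟨ht.1, ht.2.le⟩] at h1
  refine h1.unique ((hasDerivAt_const t (b T)).congr_of_eventuallyEq ?_)
  filter_upwards [isOpen_Ioo.mem_nhds ht] with s hs
  exact h.interaction_const hM hN hT ⟨hs.1, hs.2.le⟩

lemma exists_const_relation (h : TwoClassFlow M N T f g a c b z) (hM : 3 ≤ M) (hN : 3 ≤ N)
    (hT : 0 < T) {j : ℕ} (hj : 1 ≤ j) (hjN : j ≤ N) :
    ∃ k : ℝ, ∀ t ∈ Ioo 0 T,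
      (relationPoly (birthRate M f) (excess N M (fun i j => g j i) (fun i j => f j i)) j).eval
        (Real.exp (-b T)) * Real.exp (-a t) +
      (crossCoeff M N f g j * Real.exp (-b T)) * Real.exp (-c t) + k = 0 := by
  obtain ⟨k, hk⟩ := h.exists_relation' (j := j) (by omega) hT hj hjN
  refine ⟨k, fun t ht => ?_⟩
  have := hk t ht
  rw [h.interaction_const hM hN hT ⟨ht.1, ht.2.le⟩] at this
  linear_combination this

lemma exists_odds_dependence (h : TwoClassFlow M N T f g a c b z) (hM : 3 ≤ M) (hN : 3 ≤ N)
    (hT : 0 < T) (hb : b T ≠ 0) :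
    ∃ α β γ : ℝ, (α ≠ 0 ∨ β ≠ 0) ∧
      ∀ t ∈ Ioo 0 T, α * Real.exp (-a t) + β * Real.exp (-c t) + γ = 0 := by
  obtain ⟨k₂, hk₂⟩ := h.exists_const_relation hM hN hT (j := 2) (by omega) (by omega)
  obtain ⟨k₃, hk₃⟩ := h.exists_const_relation hM hN hT (j := 3) (by omega) (by omega)
  have hA := h.birthRate_pos (by omega) hT
  set A := birthRate M f
  set e := excess N M (fun i j => g j i) (fun i j => f j i)
  set y := Real.exp (-b T) with hy
  by_contra hno
  have h2 : (relationPoly A e 2).eval y = 0 := by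
    by_contra hne
    exact hno ⟨_, _, _, Or.inl hne, hk₂⟩
  have h3 : (relationPoly A e 3).eval y = 0 := by
    by_contra hne
    exact hno ⟨_, _, _, Or.inl hne, hk₃⟩
  have hy1 : 1 - y ≠ 0 := by
    intro h1
    apply hb
    have : Real.exp (-b T) = 1 := by linarith
    rw [Real.exp_eq_one_iff] at this
    linarith
  rw [eval_relationPoly] at h2 h3
  push_cast at h2 h3
  have h2' : (1 - y) * (-A + (A + 2 * e) * y) = 0 := by linear_combination h2
  have h3' : (1 - y) * (-2 * A + (A + 3 * e) * (y + y ^ 2)) = 0 := by linear_combination h3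
  have e2 := (mul_eq_zero.mp h2').resolve_left hy1
  have e3 := (mul_eq_zero.mp h3').resolve_left hy1
  -- This combination eliminates the excess e.
  have : A * (1 - y) ^ 2 = 0 := by linear_combination -2 * e3 + 3 * (1 + y) * e2
  rcases mul_eq_zero.mp this with h0 | h0
  · exact hA.ne' h0
  · exact hy1 (by simpa using h0)

end TwoClassFlow

namespace TwoClassFlow

variable {M N : ℕ} {T : ℝ} {f g : ℕ → ℕ → ℝ} {a c b z : ℝ → ℝ}

lemma excess_relation (h : TwoClassFlow M N T f g a c b z) (hM : 3 ≤ M) (hN : 3 ≤ N)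
    (hT : 0 < T) {δ : ℝ}
    (hAB : ∀ t ∈ Ioo 0 T, birthRate N (fun i j => g j i) * Real.exp (-c t) =
        birthRate M f * Real.exp (-a t) + δ) :
    Real.exp (-b T) * (excess N M (fun i j => g j i) (fun i j => f j i) *
        birthRate N (fun i j => g j i) + excess M N f g * birthRate M f) =
      2 * birthRate M f * birthRate N (fun i j => g j i) * (1 - Real.exp (-b T)) := by
  have := (h.coeff_of_odds_relation hT hAB fun t ht => h.interactionDrift_eq_zero hM hN hT ht).1
  linear_combination this

/-- For δ = 0 the constant term of the interaction drift vanishes by itself; the cross coefficients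
for j = 2 serve to eliminate the rates out of type (1, 1). -/
lemma drift_const (h : TwoClassFlow M N T f g a c b z) (hM : 3 ≤ M) (hN : 3 ≤ N)
    (hT : 0 < T)
    (hAB : ∀ t ∈ Ioo 0 T, birthRate N (fun i j => g j i) * Real.exp (-c t) =
        birthRate M f * Real.exp (-a t) + 0)
    (hκ : growthRate N (fun i j => g j i) (fun i j => f j i) = growthRate M f g) :
    2 * (excess M N f g + excess N M (fun i j => g j i) (fun i j => f j i)) +
      (N - 1) * crossCoeff M N f g 2 +
      (M - 1) * crossCoeff N M (fun i j => g j i) (fun i j => f j i) 2 = 0 := by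
  have h1 := (h.coeff_of_odds_relation hT hAB fun t ht => h.interactionDrift_eq_zero hM hN hT ht).2
  have hB := h.swap.birthRate_pos (by omega) hT
  rw [mul_zero, zero_add] at h1
  have h2 := (mul_eq_zero.mp h1).resolve_right hB.ne'
  have hM' : (M : ℝ) ≠ 0 := by positivity
  have hN' : (N : ℝ) ≠ 0 := by positivity
  have hM1 : (M : ℝ) - 1 ≠ 0 := by
    have : (3 : ℝ) ≤ M := by exact_mod_cast hM
    linarith
  have hN1 : (N : ℝ) - 1 ≠ 0 := by
    have : (3 : ℝ) ≤ N := by exact_mod_cast hN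
    linarith
  have hf : f 0 0 = M * birthRate M f := by unfold birthRate; field_simp
  have hg : g 0 0 = N * birthRate N (fun i j => g j i) := by unfold birthRate; field_simp
  have ha : N * excess M N f g = birthRate M f - growthRate M f g := by
    unfold excess; field_simp
  have hb : M * excess N M (fun i j => g j i) (fun i j => f j i) =
      birthRate N (fun i j => g j i) - growthRate M f g := by
    rw [← hκ]; unfold excess; field_simp
  have hm : (N - 1) * crossCoeff M N f g 2 = 2 * (N - 1) *
      (birthRate N (fun i j => g j i) + excess M N f g) - 2 * (g 1 1 / (M * N)) := by
    rw [crossCoeff, Nat.cast_choose_two]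
    push_cast
    field_simp
  have hn : (M - 1) * crossCoeff N M (fun i j => g j i) (fun i j => f j i) 2 = 2 * (M - 1) *
      (birthRate M f + excess N M (fun i j => g j i) (fun i j => f j i)) -
        2 * (f 1 1 / (M * N)) := by
    rw [crossCoeff, Nat.cast_choose_two]
    push_cast
    field_simp
  rw [hκ, hf, hg, add_div] at h2
  linear_combination hm + hn + 2 * ha + 2 * hb + 2 * h2

lemma crossCoeff_relation (h : TwoClassFlow M N T f g a c b z) (hM : 3 ≤ M) (hN : 3 ≤ N)
    (hT : 0 < T) {A B δ : ℝ}
    (hAB : ∀ t ∈ Ioo 0 T, B * Real.exp (-c t) = A * Real.exp (-a t) + δ) :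
    (-birthRate M f + 2 * (birthRate M f + excess N M (fun i j => g j i) (fun i j => f j i)) *
        Real.exp (-b T) -
      (birthRate M f + 2 * excess N M (fun i j => g j i) (fun i j => f j i)) *
        Real.exp (-b T) ^ 2) * B + crossCoeff M N f g 2 * Real.exp (-b T) * A = 0 := by
  obtain ⟨k, hk⟩ := h.exists_const_relation hM hN hT (j := 2) (by omega) (by omega)
  have := (h.coeff_of_odds_relation hT hAB hk).1
  rw [eval_relationPoly] at this
  push_cast at this
  linear_combination this

end TwoClassFlow

/-! ### Exclusion of both cases near zero interaction -/

lemma eventually_not_equal_growth {M N : ℕ} (hM : 3 ≤ M) (hN : 3 ≤ N) {α₁ α₂ : ℝ}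
    (hα : α₁ ≠ α₂) :
    ∀ᶠ y in 𝓝 (1 : ℝ), ∀ (T : ℝ) (f g : ℕ → ℕ → ℝ) (a c b z : ℝ → ℝ), 0 < T →
      TwoClassFlow M N T f g a c b z → a T = α₁ → c T = α₂ → Real.exp (-b T) = y →
      (∀ t ∈ Ioo 0 T, birthRate N (fun i j => g j i) * Real.exp (-c t) =
        birthRate M f * Real.exp (-a t) + 0) →
      growthRate N (fun i j => g j i) (fun i j => f j i) = growthRate M f g → False := by
  have hM0 : (0 : ℝ) < M := by positivity
  have hN0 : (0 : ℝ) < N := by positivity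
  have hρ1 : Real.exp (α₁ - α₂) ≠ 1 := by
    rw [Ne, Real.exp_eq_one_iff, sub_eq_zero]
    exact hα
  filter_upwards [eventually_no_equal_growth hM0 hN0 (Real.exp_pos (α₁ - α₂)) hρ1] with y hy
  rintro T f g a c b z hT h rfl rfl rfl hAB hκ
  have hterm := h.odds_relation_terminal hT hAB
  have e1 := h.excess_relation hM hN hT hAB
  have e3 := h.drift_const hM hN hT hAB hκ
  have e4 := h.crossCoeff_relation hM hN hT hAB
  have e5 := h.swap.crossCoeff_relation hN hM hT (A := birthRate N (fun i j => g j i))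
    (B := birthRate M f) (δ := 0) fun t ht => by rw [hAB t ht]; ring
  have hB := h.swap.birthRate_pos (by omega) hT
  have ha : N * excess M N f g = birthRate M f - growthRate M f g := by
    unfold excess; field_simp
  have hb : M * excess N M (fun i j => g j i) (fun i j => f j i) =
      birthRate N (fun i j => g j i) - growthRate M f g := by
    rw [← hκ]; unfold excess; field_simp
  set A := birthRate M f
  set B := birthRate N (fun i j => g j i)
  set ea := excess M N f g
  set eb := excess N M (fun i j => g j i) (fun i j => f j i)
  set m := crossCoeff M N f g 2
  set n := crossCoeff N M (fun i j => g j i) (fun i j => f j i) 2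
  have hA : A = Real.exp (a T - c T) * B := by
    have h1 : Real.exp (-c T) = Real.exp (a T - c T) * Real.exp (-a T) := by
      rw [← Real.exp_add]; ring_nf
    rw [h1] at hterm
    have : Real.exp (-a T) * (A - Real.exp (a T - c T) * B) = 0 := by linear_combination -hterm
    linarith [(mul_eq_zero.mp this).resolve_left (Real.exp_pos _).ne']
  set ρ := Real.exp (a T - c T)
  set y := Real.exp (-b T)
  refine hy (Real.exp_pos _) (ea / B) (eb / B) (m / B) (n / B) ?_ ?_ ?_ ?_ ?_
  · rw [hA] at e1
    field_simp
    have : B * (y * (eb + ea * ρ)) = B * (B * (2 * ρ * (1 - y))) := by linear_combination e1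
    linear_combination mul_left_cancel₀ hB.ne' this
  · rw [hA] at ha
    field_simp
    linear_combination hb - ha
  · field_simp
    linear_combination e3
  · rw [hA] at e4
    have : B * ((-(ρ * B) + 2 * (ρ * B + eb) * y - (ρ * B + 2 * eb) * y ^ 2) + m * y * ρ) =
      B * 0 := by linear_combination e4
    have := mul_left_cancel₀ hB.ne' this
    field_simp
    linear_combination this
  · rw [hA] at e5
    have : B * ((-B + 2 * (B + ea) * y - (B + 2 * ea) * y ^ 2) * ρ + n * y) =
      B * 0 := by linear_combination e5
    have := mul_left_cancel₀ hB.ne' this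
    field_simp
    linear_combination this

lemma eventually_not_opposite_growth {M N : ℕ} (hM : 3 ≤ M) (hN : 3 ≤ N) (α₂ : ℝ) :
    ∀ᶠ y in 𝓝 (1 : ℝ), ∀ (T : ℝ) (f g : ℕ → ℕ → ℝ) (a c b z : ℝ → ℝ), 0 < T →
      TwoClassFlow M N T f g a c b z → c T = α₂ → Real.exp (-b T) = y →
      (∀ t ∈ Ioo 0 T, birthRate N (fun i j => g j i) * Real.exp (-c t) =
        birthRate M f * Real.exp (-a t) + growthRate M f g) →
      growthRate N (fun i j => g j i) (fun i j => f j i) = -growthRate M f g →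
      0 < growthRate M f g → False := by
  have hM1 : (1 : ℝ) ≤ M := by exact_mod_cast (by omega : 1 ≤ M)
  have hN1 : (1 : ℝ) ≤ N := by exact_mod_cast (by omega : 1 ≤ N)
  have hM0 : (0 : ℝ) < M := by linarith
  have hN0 : (0 : ℝ) < N := by linarith
  filter_upwards [eventually_no_opposite_growth hM1 hN1 (Real.exp_pos α₂)] with y hy
  rintro T f g a c b z hT h rfl rfl hAB hκ hpos
  have hterm := h.odds_relation_terminal hT hAB
  have hA := h.birthRate_pos (by omega) hT
  have e1 := h.excess_relation hM hN hT hAB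
  have hq := h.growthRate_le (by omega) hT
  have hf : f 0 0 = M * birthRate M f := by unfold birthRate; field_simp
  have hg : g 0 0 = N * birthRate N (fun i j => g j i) := by unfold birthRate; field_simp
  have ha : N * excess M N f g = birthRate M f - growthRate M f g := by
    unfold excess; field_simp
  have hb : M * excess N M (fun i j => g j i) (fun i j => f j i) =
      birthRate N (fun i j => g j i) + growthRate M f g := by
    rw [← sub_neg_eq_add, ← hκ]; unfold excess; field_simp
  refine hy (Real.exp_pos _) (birthRate M f) (birthRate N (fun i j => g j i)) (growthRate M f g)
    hA hpos ?_ ?_ ?_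
  -- At time T the relation BY = AX + κ with AX > 0 gives κ ≤ B exp(-c(T)), a bound on B/κ depending
  -- on the terminal value alone.
  · have h1 : growthRate M f g ≤ birthRate N (fun i j => g j i) * Real.exp (-c T) := by
      rw [hterm]
      have := Real.exp_pos (-a T)
      have : 0 < birthRate M f * Real.exp (-a T) := by positivity
      linarith
    calc Real.exp (c T) * growthRate M f g
        ≤ Real.exp (c T) * (birthRate N (fun i j => g j i) * Real.exp (-c T)) := by gcongr
      _ = birthRate N (fun i j => g j i) * (Real.exp (c T) * Real.exp (-c T)) := by ring
      _ = birthRate N (fun i j => g j i) := by rw [← Real.exp_add]; simp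
  · rw [← hf, ← hg]
    exact hq
  · linear_combination M * N * e1 -
      Real.exp (-b T) * birthRate N (fun i j => g j i) * N * hb -
      Real.exp (-b T) * birthRate M f * M * ha

/-- For distinct terminal vertex parameters and a small nonzero terminal interaction there is no
flow of the two-class model. -/
theorem eventually_no_twoClassFlow {M N : ℕ} (hM : 3 ≤ M) (hN : 3 ≤ N) {α₁ α₂ : ℝ}
    (hα : α₁ ≠ α₂) :
    ∀ᶠ β in 𝓝 (0 : ℝ), β ≠ 0 → ∀ (T : ℝ) (f g : ℕ → ℕ → ℝ) (a c b z : ℝ → ℝ), 0 < T →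
      TwoClassFlow M N T f g a c b z → a T = α₁ → c T = α₂ → b T ≠ β := by
  have hlim : Tendsto (fun β : ℝ => Real.exp (-β)) (𝓝 0) (𝓝 1) := by
    have : Continuous fun β : ℝ => Real.exp (-β) := by fun_prop
    simpa using this.tendsto 0
  filter_upwards [hlim.eventually (eventually_not_equal_growth hM hN hα),
    hlim.eventually (eventually_not_opposite_growth hM hN α₂),
    hlim.eventually (eventually_not_opposite_growth hN hM α₁)] with β h₁ h₂ h₃ hβ
  rintro T f g a c b z hT h ha hc rfl
  obtain ⟨α, β, γ, hne, hrel⟩ := h.exists_odds_dependence hM hN hT hβ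
  obtain ⟨δ, hAB, ⟨rfl, hκ⟩ | ⟨rfl, hκ⟩⟩ :=
    h.odds_dependent (by omega) (by omega) hT hne hrel
  · exact h₁ T f g a c b z hT h ha hc rfl hAB hκ
  -- Exchanging the classes reverses the sign of κ, and for κ = 0 the relation is that of the
  -- equal-growth case.
  · rcases lt_trichotomy (growthRate M f g) 0 with hs | hs | hs
    · refine h₃ T _ _ c a b z hT h.swap ha rfl (fun t ht => ?_) ?_ ?_
      · rw [hAB t ht, hκ]
        ring
      · rw [hκ, neg_neg]
      · rw [hκ]
        linarith
    · rw [hs] at hAB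
      exact h₁ T f g a c b z hT h ha hc rfl hAB (by rw [hκ, hs, neg_zero])
    · exact h₂ T f g a c b z hT h hc rfl hAB hκ hs

/-! ### Types of vertex sets of the complete bipartite graph -/

/-- The vertex sets with `i` vertices in the first class and `j` in the second. -/
def typeClass (M N i j : ℕ) : Finset (Finset (Fin M ⊕ Fin N)) :=
  Finset.univ.filter fun A => A.toLeft.card = i ∧ A.toRight.card = j

lemma mem_typeClass {M N i j : ℕ} {A : Finset (Fin M ⊕ Fin N)} :
    A ∈ typeClass M N i j ↔ A.toLeft.card = i ∧ A.toRight.card = j := by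
  simp [typeClass]

lemma card_typeClass (M N i j : ℕ) :
    (typeClass M N i j).card = M.choose i * N.choose j := by
  have : ((Finset.powersetCard i (Finset.univ : Finset (Fin M))) ×ˢ
      (Finset.powersetCard j (Finset.univ : Finset (Fin N)))).card =
      M.choose i * N.choose j := by
    simp
  rw [← this]
  refine Finset.card_equiv Finset.sumEquiv.toEquiv fun A => ?_
  simp [mem_typeClass, Finset.sumEquiv, Finset.mem_powersetCard]

lemma hamiltonian_completeBipartite {M N : ℕ} {α : Fin M ⊕ Fin N → ℝ}
    {β : Sym2 (Fin M ⊕ Fin N) → ℝ} {a c b : ℝ} (ha : ∀ i, α (Sum.inl i) = a)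
    (hc : ∀ j, α (Sum.inr j) = c)
    (hb : ∀ e ∈ (completeBipartiteGraph (Fin M) (Fin N)).edgeSet, β e = b)
    (A : Finset (Fin M ⊕ Fin N)) :
    hamiltonian (completeBipartiteGraph (Fin M) (Fin N)) α β A =
      A.toLeft.card * a + A.toRight.card * c + A.toLeft.card * A.toRight.card * b := by
  classical
  have h1 : ∑ u ∈ A, α u = A.toLeft.card * a + A.toRight.card * c := by
    conv_lhs => rw [← Finset.toLeft_disjSum_toRight (u := A)]
    rw [Finset.sum_disjSum]
    simp [ha, hc]
  have h2 : ∑ p ∈ A.toLeft ×ˢ A.toRight, b = A.toLeft.card * A.toRight.card * b := by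
    simp [Finset.card_product]
  rw [hamiltonian, h1, ← h2]
  congr 1
  symm
  refine Finset.sum_bij (fun p _ => s(Sum.inl p.1, Sum.inr p.2)) ?_ ?_ ?_ ?_
  · rintro ⟨i, j⟩ hij
    simp only [Finset.mem_product, Finset.mem_toLeft, Finset.mem_toRight] at hij
    simp [hij]
  · rintro ⟨i, j⟩ - ⟨i', j'⟩ - hij
    simpa using hij
  · intro e he
    induction e using Sym2.ind with
    | _ x y =>
      simp only [Finset.mem_filter, Finset.mem_univ, true_and, SimpleGraph.mem_edgeSet,
        Sym2.mem_iff, forall_eq_or_imp, forall_eq] at he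
      rcases x with x | x <;> rcases y with y | y
      · simp at he
      · exact ⟨(x, y), by simpa using he.2, rfl⟩
      · exact ⟨(y, x), by simpa using he.2.symm, Sym2.eq_swap⟩
      · simp at he
  · rintro ⟨i, j⟩ -
    exact (hb _ (by simp)).symm

/-! ### Lumping the forward equations -/

/-- The total rate of the jumps from sets of type `(i, j)` to sets of type `(i', j')`. -/
noncomputable def totalRate {M N : ℕ}
    (Q : Matrix (Finset (Fin M ⊕ Fin N)) (Finset (Fin M ⊕ Fin N)) ℝ) (i j i' j' : ℕ) : ℝ :=
  ∑ A ∈ typeClass M N i j, ∑ B ∈ typeClass M N i' j', Q A B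

section Lumping

variable {M N : ℕ} {Q : Matrix (Finset (Fin M ⊕ Fin N)) (Finset (Fin M ⊕ Fin N)) ℝ}

lemma jump_type (hjump : ∀ A B, A ≠ B → Q A B ≠ 0 → ∃ v, v ∉ A ∧ B = insert v A)
    {A B : Finset (Fin M ⊕ Fin N)} (hAB : A ≠ B) (hQ : Q A B ≠ 0) :
    (B.toLeft.card = A.toLeft.card + 1 ∧ B.toRight.card = A.toRight.card) ∨
      (B.toLeft.card = A.toLeft.card ∧ B.toRight.card = A.toRight.card + 1) := by
  obtain ⟨v, hv, rfl⟩ := hjump A B hAB hQ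
  rcases v with v | v
  · left
    simp [Finset.card_insert_of_notMem, hv]
  · right
    simp [Finset.card_insert_of_notMem, hv]

lemma sum_eq_diag_add {S : Type*} [Fintype S] [DecidableEq S] (F : S → ℝ) (A : S)
    (L R : Finset S) (hL : A ∉ L) (hR : A ∉ R) (hLR : Disjoint L R)
    (hF : ∀ B, B ≠ A → B ∉ L → B ∉ R → F B = 0) :
    ∑ B, F B = F A + (∑ B ∈ L, F B + ∑ B ∈ R, F B) := by
  rw [← Finset.sum_union hLR, ← Finset.sum_insert (by simp [hL, hR])]
  symm
  refine Finset.sum_subset (Finset.subset_univ _) fun B _ hB => ?_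
  simp only [Finset.mem_insert, Finset.mem_union, not_or] at hB
  exact hF B hB.1 hB.2.1 hB.2.2

lemma disjoint_typeClass {i j i' j' : ℕ} (h : i ≠ i' ∨ j ≠ j') :
    Disjoint (typeClass M N i j) (typeClass M N i' j') := by
  rw [Finset.disjoint_left]
  intro A h1 h2
  rw [mem_typeClass] at h1 h2
  omega

lemma diag_eq (hQ : IsRateMatrix Q)
    (hjump : ∀ A B, A ≠ B → Q A B ≠ 0 → ∃ v, v ∉ A ∧ B = insert v A) {i j : ℕ}
    {A : Finset (Fin M ⊕ Fin N)} (hA : A ∈ typeClass M N i j) :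
    Q A A = -(∑ B ∈ typeClass M N (i + 1) j, Q A B + ∑ B ∈ typeClass M N i (j + 1), Q A B) := by
  have h1 : ∑ B, Q A B = 0 := by
    rw [← Finset.add_sum_erase _ _ (Finset.mem_univ A), hQ.diag A]
    ring
  rw [mem_typeClass] at hA
  rw [sum_eq_diag_add (fun B => Q A B) A (typeClass M N (i + 1) j) (typeClass M N i (j + 1))
    (by rw [mem_typeClass]; omega) (by rw [mem_typeClass]; omega)
    (disjoint_typeClass (by omega)) fun B hB h1 h2 => by
      by_contra hne
      have := jump_type hjump hB.symm hne
      rw [mem_typeClass] at h1 h2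
      omega] at h1
  linarith

/-- The sets preceding those of type `(i, j)` by a vertex of the first class. -/
def leftPred (M N i j : ℕ) : Finset (Finset (Fin M ⊕ Fin N)) :=
  if i = 0 then ∅ else typeClass M N (i - 1) j

/-- The sets preceding those of type `(i, j)` by a vertex of the second class. -/
def rightPred (M N i j : ℕ) : Finset (Finset (Fin M ⊕ Fin N)) :=
  if j = 0 then ∅ else typeClass M N i (j - 1)

lemma mem_leftPred {i j : ℕ} {A : Finset (Fin M ⊕ Fin N)} :
    A ∈ leftPred M N i j ↔ A.toLeft.card + 1 = i ∧ A.toRight.card = j := by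
  unfold leftPred
  split_ifs with h
  · simp; omega
  · rw [mem_typeClass]; omega

lemma mem_rightPred {i j : ℕ} {A : Finset (Fin M ⊕ Fin N)} :
    A ∈ rightPred M N i j ↔ A.toLeft.card = i ∧ A.toRight.card + 1 = j := by
  unfold rightPred
  split_ifs with h
  · simp; omega
  · rw [mem_typeClass]; omega

/-- The index is left as `i - 1 + 1` so that the summand is literally the rate function `f` at `i -
1`. -/
lemma sum_leftPred (i j : ℕ) :
    ∑ A ∈ typeClass M N i j, ∑ B ∈ leftPred M N i j, Q B A =
      if i = 0 then 0 else totalRate Q (i - 1) j (i - 1 + 1) j := by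
  rcases i with _ | i
  · simp [leftPred]
  · simp [leftPred, totalRate, Finset.sum_comm]

lemma sum_rightPred (i j : ℕ) :
    ∑ A ∈ typeClass M N i j, ∑ B ∈ rightPred M N i j, Q B A =
      if j = 0 then 0 else totalRate Q i (j - 1) i (j - 1 + 1) := by
  rcases j with _ | j
  · simp [rightPred]
  · simp [rightPred, totalRate, Finset.sum_comm]

/-- The mass is constant on each type and thus factors out of the sums of rates; its ratio to the
mass of a predecessor type produces the two exponentials. -/
lemma lumped_forward (hQ : IsRateMatrix Q)
    (hjump : ∀ A B, A ≠ B → Q A B ≠ 0 → ∃ v, v ∉ A ∧ B = insert v A)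
    {a c b z : ℝ} {p : Finset (Fin M ⊕ Fin N) → ℝ}
    (hp : ∀ A, p A = Real.exp (A.toLeft.card * a + A.toRight.card * c +
      A.toLeft.card * A.toRight.card * b - z)) (i j : ℕ) :
    ∑ A ∈ typeClass M N i j, ∑ B, p B * Q B A =
      (-(totalRate Q i j (i + 1) j + totalRate Q i j i (j + 1)) +
        (if i = 0 then 0 else totalRate Q (i - 1) j (i - 1 + 1) j) * Real.exp (-a - j * b) +
        (if j = 0 then 0 else totalRate Q i (j - 1) i (j - 1 + 1)) * Real.exp (-c - i * b)) *
      Real.exp (i * a + j * c + i * j * b - z) := by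
  set E := Real.exp (i * a + j * c + i * j * b - z) with hE
  have hcol : ∀ A ∈ typeClass M N i j, ∑ B, p B * Q B A =
      (-(∑ B ∈ typeClass M N (i + 1) j, Q A B + ∑ B ∈ typeClass M N i (j + 1), Q A B) +
        (∑ B ∈ leftPred M N i j, Q B A) * Real.exp (-a - j * b) +
        (∑ B ∈ rightPred M N i j, Q B A) * Real.exp (-c - i * b)) * E := by
    intro A hA
    have hA' := mem_typeClass.mp hA
    have h1 : ∑ B ∈ leftPred M N i j, p B * Q B A =
        (∑ B ∈ leftPred M N i j, Q B A) * Real.exp (-a - j * b) * E := by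
      rw [mul_assoc, Finset.sum_mul]
      refine Finset.sum_congr rfl fun B hB => ?_
      obtain ⟨rfl, rfl⟩ := mem_leftPred.mp hB
      rw [hp B, hE, ← Real.exp_add, mul_comm]
      congr 2
      push_cast
      ring
    have h2 : ∑ B ∈ rightPred M N i j, p B * Q B A =
        (∑ B ∈ rightPred M N i j, Q B A) * Real.exp (-c - i * b) * E := by
      rw [mul_assoc, Finset.sum_mul]
      refine Finset.sum_congr rfl fun B hB => ?_
      obtain ⟨rfl, rfl⟩ := mem_rightPred.mp hB
      rw [hp B, hE, ← Real.exp_add, mul_comm]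
      congr 2
      push_cast
      ring
    rw [sum_eq_diag_add (fun B => p B * Q B A) A (leftPred M N i j) (rightPred M N i j)
      (by rw [mem_leftPred]; omega) (by rw [mem_rightPred]; omega)
      (by
        rw [Finset.disjoint_left]
        intro B h1 h2
        rw [mem_leftPred] at h1
        rw [mem_rightPred] at h2
        omega) fun B hB h1 h2 => by
        rw [mul_eq_zero]
        right
        by_contra hne
        have := jump_type hjump hB hne
        rw [mem_leftPred] at h1
        rw [mem_rightPred] at h2
        omega]
    rw [h1, h2, diag_eq hQ hjump hA, hp A, hA'.1, hA'.2, ← hE]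
    ring
  rw [Finset.sum_congr rfl hcol, ← Finset.sum_mul, Finset.sum_add_distrib,
    Finset.sum_add_distrib, ← Finset.sum_mul, ← Finset.sum_mul, sum_leftPred, sum_rightPred,
    Finset.sum_neg_distrib, Finset.sum_add_distrib]
  rfl

lemma totalRate_nonneg (hQ : IsRateMatrix Q) {i j i' j' : ℕ} (h : i ≠ i' ∨ j ≠ j') :
    0 ≤ totalRate Q i j i' j' := by
  refine Finset.sum_nonneg fun A hA => Finset.sum_nonneg fun B hB => hQ.nonneg A B ?_
  rintro rfl
  exact Finset.disjoint_left.mp (disjoint_typeClass h) hA hB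

lemma typeClass_eq_empty {i j : ℕ} (h : M < i ∨ N < j) : typeClass M N i j = ∅ := by
  rw [← Finset.card_eq_zero, card_typeClass]
  rcases h with h | h <;> simp [Nat.choose_eq_zero_of_lt h]

/-- The law determines its parameters, so they inherit continuity from it, and those of the flow at
time T are the prescribed ones. -/
lemma params_eq_log {i : Fin M} {j : Fin N} {p : Finset (Fin M ⊕ Fin N) → ℝ} {a c b z : ℝ}
    (hp : ∀ A, p A = Real.exp (A.toLeft.card * a + A.toRight.card * c +
      A.toLeft.card * A.toRight.card * b - z)) :
    a = Real.log (p {Sum.inl i}) - Real.log (p ∅) ∧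
      c = Real.log (p {Sum.inr j}) - Real.log (p ∅) ∧
      b = Real.log (p {Sum.inl i, Sum.inr j}) - Real.log (p {Sum.inl i}) -
        Real.log (p {Sum.inr j}) + Real.log (p ∅) := by
  have h1 : ({Sum.inl i} : Finset (Fin M ⊕ Fin N)).toLeft = {i} := by ext; simp
  have h2 : ({Sum.inl i} : Finset (Fin M ⊕ Fin N)).toRight = ∅ := by ext; simp
  have h3 : ({Sum.inr j} : Finset (Fin M ⊕ Fin N)).toLeft = ∅ := by ext; simp
  have h4 : ({Sum.inr j} : Finset (Fin M ⊕ Fin N)).toRight = {j} := by ext; simp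
  have h5 : (∅ : Finset (Fin M ⊕ Fin N)).toLeft = ∅ := by ext; simp
  have h6 : (∅ : Finset (Fin M ⊕ Fin N)).toRight = ∅ := by ext; simp
  have h7 : ({Sum.inl i, Sum.inr j} : Finset (Fin M ⊕ Fin N)).toLeft = {i} := by ext; simp
  have h8 : ({Sum.inl i, Sum.inr j} : Finset (Fin M ⊕ Fin N)).toRight = {j} := by ext; simp
  simp only [hp, Real.log_exp, h1, h2, h3, h4, h5, h6, h7, h8, Finset.card_singleton,
    Finset.card_empty, Nat.cast_one, Nat.cast_zero]
  refine ⟨?_, ?_, ?_⟩ <;> ring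

theorem twoClassFlow_of_forward (hM : 0 < M) (hN : 0 < N) {T : ℝ} (hT : 0 < T)
    (hQ : IsRateMatrix Q)
    (hjump : ∀ A B, A ≠ B → Q A B ≠ 0 → ∃ v, v ∉ A ∧ B = insert v A)
    {p : ℝ → Finset (Fin M ⊕ Fin N) → ℝ}
    (hp : ∀ A t, HasDerivAt (fun s => p s A) (∑ B, p t B * Q B A) t)
    (hp0 : p 0 ∅ = 1) (hp0' : ∀ A, A ≠ ∅ → p 0 A = 0) {a c b z : ℝ → ℝ}
    (hlaw : ∀ t ∈ Ioc 0 T, ∀ A, p t A = Real.exp (A.toLeft.card * a t + A.toRight.card * c t +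
      A.toLeft.card * A.toRight.card * b t - z t)) :
    TwoClassFlow M N T (fun i j => totalRate Q i j (i + 1) j)
      (fun i j => totalRate Q i j i (j + 1)) a c b z := by
  have hcont : ∀ A, Continuous fun t => p t A := fun A =>
    continuous_iff_continuousAt.mpr fun t => (hp A t).continuousAt
  have hpos : ∀ A, ∀ t ∈ Ioc 0 T, 0 < p t A := fun A t ht => by
    rw [hlaw t ht]
    exact Real.exp_pos _
  have hlogc : ∀ A, ContinuousOn (fun t => Real.log (p t A)) (Ioc 0 T) := fun A =>
    (hcont A).continuousOn.log fun t ht => (hpos A t ht).ne'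
  let x : Fin M ⊕ Fin N := Sum.inl ⟨0, hM⟩
  let y : Fin M ⊕ Fin N := Sum.inr ⟨0, hN⟩
  have ha : ∀ t ∈ Ioc 0 T, a t = Real.log (p t {x}) - Real.log (p t ∅) := fun t ht =>
    (params_eq_log (j := ⟨0, hN⟩) (hlaw t ht)).1
  have hc : ∀ t ∈ Ioc 0 T, c t = Real.log (p t {y}) - Real.log (p t ∅) := fun t ht =>
    (params_eq_log (i := ⟨0, hM⟩) (hlaw t ht)).2.1
  have hb : ∀ t ∈ Ioc 0 T, b t = Real.log (p t {x, y}) - Real.log (p t {x}) -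
      Real.log (p t {y}) + Real.log (p t ∅) := fun t ht =>
    (params_eq_log (hlaw t ht)).2.2
  have hlim : ∀ v : Fin M ⊕ Fin N, Tendsto (fun t => Real.log (p t {v}) - Real.log (p t ∅))
      (𝓝[>] 0) atBot := by
    intro v
    have h1 : Tendsto (fun t => p t {v}) (𝓝[>] 0) (𝓝[>] 0) := by
      refine tendsto_nhdsWithin_of_tendsto_nhds_of_eventually_within _ ?_ ?_
      · have := (hcont {v}).tendsto 0
        rw [hp0' _ (Finset.singleton_ne_empty v)] at this
        exact this.mono_left nhdsWithin_le_nhds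
      · filter_upwards [Ioc_mem_nhdsGT hT] with t ht using hpos _ t ht
    have h2 : Tendsto (fun t => -Real.log (p t ∅)) (𝓝[>] 0) (𝓝 0) := by
      have h3 : ContinuousAt (fun t => -Real.log (p t ∅)) 0 :=
        ((hcont ∅).continuousAt.log (by rw [hp0]; exact one_ne_zero)).neg
      have := h3.tendsto
      rw [hp0, Real.log_one, neg_zero] at this
      exact this.mono_left nhdsWithin_le_nhds
    simpa only [sub_eq_add_neg, Function.comp_apply] using (Real.tendsto_log_nhdsGT_zero.comp h1).atBot_add h2
  refine ⟨fun i j => totalRate_nonneg hQ (by omega), fun i j => totalRate_nonneg hQ (by omega),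
    fun j => by simp [totalRate, typeClass_eq_empty], fun i => by
      simp [totalRate, typeClass_eq_empty], ?_, ?_, ?_, ?_, ?_, ?_⟩
  · intro i j hi hj t ht
    have ht' : t ∈ Ioc 0 T := ⟨ht.1, ht.2.le⟩
    have hC : (0 : ℝ) < M.choose i * N.choose j := by
      exact_mod_cast Nat.mul_pos (Nat.choose_pos hi) (Nat.choose_pos hj)
    have hsum : ∀ s ∈ Ioc 0 T, ∑ A ∈ typeClass M N i j, p s A =
        (M.choose i * N.choose j) *
          Real.exp (i * a s + j * c s + i * j * b s - z s) := fun s hs => by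
      rw [Finset.sum_congr rfl fun A hA => by
        rw [hlaw s hs, (mem_typeClass.mp hA).1, (mem_typeClass.mp hA).2],
        Finset.sum_const, card_typeClass, nsmul_eq_mul]
      push_cast
      ring
    have h1 : HasDerivAt (fun s => ∑ A ∈ typeClass M N i j, p s A)
        (∑ A ∈ typeClass M N i j, ∑ B, p t B * Q B A) t :=
      HasDerivAt.fun_sum fun A _ => hp A t
    rw [lumped_forward hQ hjump (hlaw t ht')] at h1
    have h2 := (h1.div_const ((M.choose i * N.choose j : ℝ))).log (by
      rw [hsum t ht', mul_div_cancel_left₀ _ hC.ne']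
      exact (Real.exp_pos _).ne')
    refine (h2.congr_deriv ?_).congr_of_eventuallyEq ?_
    · rw [hsum t ht', mul_div_cancel_left₀ _ hC.ne']
      have := Real.exp_pos (i * a t + j * c t + i * j * b t - z t)
      field_simp
    · filter_upwards [isOpen_Ioo.mem_nhds ht] with s hs
      rw [hsum s ⟨hs.1, hs.2.le⟩, mul_div_cancel_left₀ _ hC.ne', Real.log_exp]
  · exact ((hlogc _).sub (hlogc _)).congr ha
  · exact ((hlogc _).sub (hlogc _)).congr hc
  · exact ((((hlogc _).sub (hlogc _)).sub (hlogc _)).add (hlogc _)).congr hb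
  · refine (hlim x).congr' ?_
    filter_upwards [Ioc_mem_nhdsGT hT] with t ht using (ha t ht).symm
  · refine (hlim y).congr' ?_
    filter_upwards [Ioc_mem_nhdsGT hT] with t ht using (hc t ht).symm

end Lumping

/-! ### The law of the chain -/

section Law

attribute [local instance] Matrix.linftyOpNormedRing Matrix.linftyOpNormedAlgebra

lemma hasDerivAt_matrix_exp {S : Type*} [Fintype S] [DecidableEq S] (Q : Matrix S S ℝ) (A B : S)
    (t : ℝ) :
    HasDerivAt (fun s : ℝ => NormedSpace.exp (s • Q) A B)
      (∑ C, NormedSpace.exp (t • Q) A C * Q C B) t := by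
  have h1 : HasDerivAt (fun s : ℝ => NormedSpace.exp (s • Q))
      (NormedSpace.exp (t • Q) * Q) t := hasDerivAt_exp_smul_const Q t
  let ev : Matrix S S ℝ →L[ℝ] ℝ :=
    LinearMap.toContinuousLinearMap (Matrix.entryLinearMap ℝ ℝ A B)
  exact ev.hasFDerivAt.comp_hasDerivAt t h1

end Law

lemma IsMarkovChain.law {S : Type} [Fintype S] [DecidableEq S] {Ω : Type u} [MeasurableSpace Ω]
    {μ : Measure Ω} [IsProbabilityMeasure μ] {X : ℝ≥0 → Ω → S} {Q : Matrix S S ℝ}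
    (hX : IsMarkovChain μ X Q) {A : S} (h0 : ∀ᵐ ω ∂μ, X 0 ω = A) (t : ℝ≥0) (B : S) :
    μ.real {ω | X t ω = B} = NormedSpace.exp ((t : ℝ) • Q) A B := by
  -- The Markov property with the single observation time 0, where the state is almost surely A.
  have h := hX.markov 0 (fun _ => 0) (fun _ => A) monotone_const t B
  simp only [forall_const, zero_add] at h
  have h1 : μ.real {ω | X 0 ω = A} = 1 := by
    have : μ.real {ω | X 0 ω = A} = μ.real univ :=
      measureReal_congr (by
        filter_upwards [h0] with ω hω
        exact propext ⟨fun _ => trivial, fun _ => hω⟩)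
    simpa using this
  have h2 : μ.real {ω | X 0 ω = A ∧ X t ω = B} = μ.real {ω | X t ω = B} :=
    measureReal_congr (by
      filter_upwards [h0] with ω hω
      exact propext ⟨fun h => h.2, fun h => ⟨hω, h⟩⟩)
  rw [h2, h1, one_mul] at h
  exact h

lemma defaultProb_completeBipartite {M N : ℕ} {α : Fin M ⊕ Fin N → ℝ}
    {β : Sym2 (Fin M ⊕ Fin N) → ℝ} {a c b : ℝ} (ha : ∀ i, α (Sum.inl i) = a)
    (hc : ∀ j, α (Sum.inr j) = c)
    (hb : ∀ e ∈ (completeBipartiteGraph (Fin M) (Fin N)).edgeSet, β e = b)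
    (A : Finset (Fin M ⊕ Fin N)) :
    defaultProb (completeBipartiteGraph (Fin M) (Fin N)) α β A =
      Real.exp (A.toLeft.card * a + A.toRight.card * c + A.toLeft.card * A.toRight.card * b -
        Real.log (partitionFunction (completeBipartiteGraph (Fin M) (Fin N)) α β)) := by
  have hZ : 0 < partitionFunction (completeBipartiteGraph (Fin M) (Fin N)) α β :=
    Finset.sum_pos (fun _ _ => Real.exp_pos _) Finset.univ_nonempty
  rw [defaultProb, hamiltonian_completeBipartite ha hc hb, Real.exp_sub, Real.exp_log hZ]

theorem TwoClassAdmits.exists_flow {M N : ℕ} (hM : 0 < M) (hN : 0 < N) {T : ℝ≥0} (hT : 0 < T)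
    {α₁ α₂ β : ℝ} (h : TwoClassAdmits.{u} M N T α₁ α₂ β) :
    ∃ (f g : ℕ → ℕ → ℝ) (a c b z : ℝ → ℝ), TwoClassFlow M N T f g a c b z ∧
      a T = α₁ ∧ c T = α₂ ∧ b T = β := by
  obtain ⟨Ω, _, μ, X, Q, hμ, hX, hjump, h0, hXT, αt, βt, hF⟩ := h
  let i₀ : Fin M := ⟨0, hM⟩
  let j₀ : Fin N := ⟨0, hN⟩
  let a : ℝ → ℝ := fun t => αt t.toNNReal (Sum.inl i₀)
  let c : ℝ → ℝ := fun t => αt t.toNNReal (Sum.inr j₀)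
  let b : ℝ → ℝ := fun t => βt t.toNNReal s(Sum.inl i₀, Sum.inr j₀)
  let z : ℝ → ℝ := fun t => Real.log (partitionFunction
    (completeBipartiteGraph (Fin M) (Fin N)) (αt t.toNNReal) (βt t.toNNReal))
  let p : ℝ → Finset (Fin M ⊕ Fin N) → ℝ := fun t A => NormedSpace.exp (t • Q) ∅ A
  have hlaw : ∀ t ∈ Ioc (0 : ℝ) T, ∀ A, p t A = Real.exp (A.toLeft.card * a t +
      A.toRight.card * c t + A.toLeft.card * A.toRight.card * b t - z t) := fun t ht A => by
    obtain ⟨⟨h1, h2, h3⟩, h4⟩ := hF t.toNNReal (Real.toNNReal_pos.mpr ht.1)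
      (Real.toNNReal_le_iff_le_coe.mpr ht.2)
    have h5 := hX.law h0 t.toNNReal A
    rw [Real.coe_toNNReal t ht.1.le] at h5
    rw [show p t A = _ from h5.symm, h4 A]
    exact defaultProb_completeBipartite (fun i => h1 i i₀) (fun j => h2 j j₀)
      (fun e he => h3 e he _ (by simp)) A
  have hTT : (T : ℝ) ∈ Ioc (0 : ℝ) T := ⟨by exact_mod_cast hT, le_rfl⟩
  have hterm : ∀ A, p T A = Real.exp (A.toLeft.card * α₁ + A.toRight.card * α₂ +
      A.toLeft.card * A.toRight.card * β - Real.log (partitionFunction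
        (completeBipartiteGraph (Fin M) (Fin N)) (Sum.elim (fun _ => α₁) (fun _ => α₂))
        (fun _ => β))) := fun A => by
    rw [show p T A = _ from (hX.law h0 T A).symm, hXT A]
    exact defaultProb_completeBipartite (fun _ => rfl) (fun _ => rfl) (fun _ _ => rfl) A
  have e1 := params_eq_log (i := i₀) (j := j₀) (hlaw T hTT)
  have e2 := params_eq_log (i := i₀) (j := j₀) hterm
  refine ⟨_, _, a, c, b, z, twoClassFlow_of_forward hM hN hTT.1 hX.rates hjump (p := p)
    (fun A t => hasDerivAt_matrix_exp Q ∅ A t) ?_ (fun A hA => ?_) hlaw,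
    e1.1.trans e2.1.symm, e1.2.1.trans e2.2.1.symm, e1.2.2.trans e2.2.2.symm⟩
  · simp [p]
  · simp [p, Matrix.one_apply_ne hA.symm]

end CorrelatedDefault

theorem proposition3 (M N : ℕ) (hMN : (4 ≤ M ∧ 3 ≤ N) ∨ (3 ≤ M ∧ 4 ≤ N))
    (T : ℝ≥0) (hT : 0 < T) (αhat αcheck : ℝ) (hα : αhat ≠ αcheck) :
    ∃ ε : ℝ, 0 < ε ∧ ∀ β : ℝ, β ≠ 0 → |β| < ε →
      ¬ CorrelatedDefault.TwoClassAdmits.{u} M N T αhat αcheck β := by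
  have hM : 3 ≤ M := by omega
  have hN : 3 ≤ N := by omega
  obtain ⟨ε, hε, h⟩ := Metric.eventually_nhds_iff.mp
    (CorrelatedDefault.eventually_no_twoClassFlow hM hN hα)
  refine ⟨ε, hε, fun β hβ hβε hadm => ?_⟩
  obtain ⟨f, g, a, c, b, z, hflow, ha, hc, hb⟩ := hadm.exists_flow (by omega) (by omega) hT
  exact h (by simpa using hβε) hβ T f g a c b z (by exact_mod_cast hT) hflow ha hc hb
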